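/- Let $R$ be a commutative ring and $n>1$. Let ${\bf P}(R)$ and ${\bf Free}(R)$ be the exact categories of finitely generated projective, respectively free, $R$-modules. Let ${\bf Nil}(R)$ (respectively ${\bf Nil}({\bf Free}(R))$) be the exact category of pairs $(P,\nu)$ with $P$ in ${\bf P}(R)$ (respectively in ${\bf Free}(R)$) and $\nu$ a nilpotent endomorphism of $P$; morphisms are the module maps commuting with the endomorphisms, and a sequence is exact if the underlying sequence of modules is. For an exact category $\mathcal N$ let $B^q\mathcal N$ be the exact category of bounded acyclic binary complexes in $\mathcal N$: bounded $\mathbb Z$-graded objects $N_*$ with two differentials of degree $-1$, each of which factors as $N_i\to Z_{i-1}\to N_{i-1}$ with all $0\to Z_i\to N_i\to Z_{i-1}\to 0$ short exact in $\mathcal N$; morphisms commute with both differentials, and exactness is degreewise. Iterating gives $(B^q)^n\mathcal N$, whose objects are the $n$-dimensional bounded acyclic binary multicomplexes $(N_*,(d_1,d_1'),\dots,(d_n,d_n'))$; such an object is diagonal if $d_i=d_i'$ for at least one $i$. Let $T^n_{\mathcal N}\subseteq K_0(B^q)^n\mathcal N$ be the subgroup generated by the classes of the diagonal objects, and let $K_n\mathcal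 N=K_0(B^q)^n\mathcal N/T^n_{\mathcal N}$. Let ${\rm Nil}_n(R)=\ker\big(K_n{\bf Nil}(R)\to K_n{\bf P}(R)\big)$, $\widetilde{\rm Nil}_n(R)=\ker\big(K_0(B^q)^n{\bf Nil}(R)\to K_0(B^q)^n{\bf P}(R)\big)$ and $\widetilde T^n_R=\ker\big(T^n_{{\bf Nil}(R)}\to T^n_{{\bf P}(R)}\big)$, all maps being induced by the forgetful functor $(P,\nu)\mapsto P$. Then the quotient map $K_0(B^q)^n{\bf Nil}(R)\to K_n{\bf Nil}(R)$ induces an isomorphism $\widetilde{\rm Nil}_n(R)/\widetilde T^n_R\cong{\rm Nil}_n(R)$, and under it the group ${\rm Nil}_n(R)$ is generated by the elements $$\big([(F_*,(f_1,f_1'),\dots,(f_n,f_n'),\nu)]-[(F_*,(f_1,f_1'),\dots,(f_n,f_n'),0)]\big)\ (\mathrm{mod}\ \widetilde T^n_R),$$ where $(F_*,(f_1,f_1'),\dots,(f_n,f_n'),\nu)$ runs over all objects of $(B^q)^n{\bf Nil}({\bf Free}(R))$ (so that $(F_*,(f_1,f_1'),\dots,(f_n,f_n'),0)$ is also such an object);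 in particular these differences lie in $\widetilde{\rm Nil}_n(R)$. -/

import Mathlib

open CategoryTheory CategoryTheory.Limits

universe u

namespace NilK

/-- A category with zero morphisms together with a distinguished class of short exact sequences
`X ⟶ Y ⟶ Z`.  This is the data of an exact category on which acyclicity, binary complexes and
the Grothendieck group depend.  It is only ever applied to the categories of finitely generated
projective (or free) modules, to these categories with nilpotent endomorphisms, and to the
categories of acyclic binary multicomplexes built from them; all of these are exact categories
in the sense of Quillen. -/
structure ExCat : Type (u + 2) where
  /-- the objects -/
  Obj : Type (u + 1)
  [cat : Category.{u} Obj]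
  [zeroMor : HasZeroMorphisms Obj]
  /-- `ses f g` says that `0 ⟶ X ⟶ Y ⟶ Z ⟶ 0` is one of the short exact sequences -/
  ses : ∀ {X Y Z : Obj}, (X ⟶ Y) → (Y ⟶ Z) → Prop

attribute [instance] ExCat.cat ExCat.zeroMor

/-- An exact functor: it preserves zero morphisms and short exact sequences. -/
structure ExFunctor (A B : ExCat.{u}) where
  /-- the underlying functor -/
  F : A.Obj ⥤ B.Obj
  [zero : F.PreservesZeroMorphisms]
  map_ses : ∀ {X Y Z : A.Obj} (f : X ⟶ Y) (g : Y ⟶ Z), A.ses f g → B.ses (F.map f) (F.map g)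

attribute [instance] ExFunctor.zero

/-! ### Bounded acyclic binary complexes -/

/-- The differential `d` on the `ℤ`-graded object `X` is acyclic: each `d i : X i ⟶ X (i - 1)`
factors as `X i ⟶ Z (i - 1) ⟶ X (i - 1)` with every `0 ⟶ Z i ⟶ X i ⟶ Z (i - 1) ⟶ 0` a short
exact sequence. -/
def Acyclic (A : ExCat.{u}) (X : ℤ → A.Obj) (d : ∀ i, X i ⟶ X (i - 1)) : Prop :=
  ∃ (Z : ℤ → A.Obj) (ι : ∀ i, Z i ⟶ X i) (p : ∀ i, X i ⟶ Z (i - 1)),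
    (∀ i, d i = p i ≫ ι (i - 1)) ∧ ∀ i, A.ses (ι i) (p i)

/-- A bounded acyclic binary complex in `A`: a bounded `ℤ`-graded object with two (not
necessarily distinct) differentials of degree `-1`, each of them acyclic. -/
structure BinCx (A : ExCat.{u}) where
  /-- the underlying graded object -/
  X : ℤ → A.Obj
  /-- the first differential -/
  d : ∀ i, X i ⟶ X (i - 1)
  /-- the second differential -/
  d' : ∀ i, X i ⟶ X (i - 1)
  d_comp_d : ∀ i, d i ≫ d (i - 1) = 0
  d'_comp_d' : ∀ i, d' i ≫ d' (i - 1) = 0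
  bounded : ∃ a b : ℤ, ∀ i, (i < a ∨ b < i) → IsZero (X i)
  acyclic : Acyclic A X d
  acyclic' : Acyclic A X d'

namespace BinCx

variable {A : ExCat.{u}}

/-- A morphism of binary complexes: a graded morphism that commutes with both differentials. -/
@[ext]
structure Hom (M N : BinCx A) where
  /-- the components -/
  f : ∀ i, M.X i ⟶ N.X i
  comm : ∀ i, M.d i ≫ f (i - 1) = f i ≫ N.d i
  comm' : ∀ i, M.d' i ≫ f (i - 1) = f i ≫ N.d' i

instance : Category (BinCx A) where
  Hom := Hom
  id M := ⟨fun _ => 𝟙 _, by simp, by simp⟩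
  comp φ ψ := ⟨fun i => φ.f i ≫ ψ.f i,
    fun i => by rw [← Category.assoc, φ.comm, Category.assoc, ψ.comm, Category.assoc],
    fun i => by rw [← Category.assoc, φ.comm', Category.assoc, ψ.comm', Category.assoc]⟩
  id_comp φ := Hom.ext (funext fun _ => Category.id_comp _)
  comp_id φ := Hom.ext (funext fun _ => Category.comp_id _)
  assoc φ ψ χ := Hom.ext (funext fun _ => Category.assoc _ _ _)

@[ext]
theorem hom_ext {M N : BinCx A} {φ ψ : M ⟶ N} (h : ∀ i, φ.f i = ψ.f i) : φ = ψ :=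
  Hom.ext (funext h)

@[simp] theorem id_f (M : BinCx A) (i : ℤ) : Hom.f (𝟙 M) i = 𝟙 (M.X i) := rfl

@[simp] theorem comp_f {M N P : BinCx A} (φ : M ⟶ N) (ψ : N ⟶ P) (i : ℤ) :
    Hom.f (φ ≫ ψ) i = φ.f i ≫ ψ.f i := rfl

instance : HasZeroMorphisms (BinCx A) where
  zero M N := ⟨⟨fun _ => 0, by simp, by simp⟩⟩
  comp_zero φ _ := hom_ext fun _ => comp_zero
  zero_comp _ _ _ ψ := hom_ext fun _ => zero_comp

@[simp] theorem zero_f (M N : BinCx A) (i : ℤ) : Hom.f (0 : M ⟶ N) i = 0 := rfl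

end BinCx

/-- The exact category `B^q A` of bounded acyclic binary complexes in `A`; a sequence is short
exact when it is so in each degree. -/
def ExCat.bq (A : ExCat.{u}) : ExCat.{u} where
  Obj := BinCx A
  cat := inferInstance
  zeroMor := inferInstance
  ses := fun {L M N : BinCx A} (φ : L ⟶ M) (ψ : M ⟶ N) => ∀ i, A.ses (φ.f i) (ψ.f i)

theorem Acyclic.map {A B : ExCat.{u}} (G : ExFunctor A B) {X : ℤ → A.Obj}
    {d : ∀ i, X i ⟶ X (i - 1)} (h : Acyclic A X d) :
    Acyclic B (fun i => G.F.obj (X i)) (fun i => G.F.map (d i)) := by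
  obtain ⟨Z, ι, p, h, h'⟩ := h
  refine ⟨fun i => G.F.obj (Z i), fun i => G.F.map (ι i), fun i => G.F.map (p i),
    fun i => ?_, fun i => G.map_ses _ _ (h' i)⟩
  change G.F.map (d i) = G.F.map (p i) ≫ G.F.map (ι (i - 1))
  rw [h i, G.F.map_comp]

/-- The functor `G` applied to a binary complex in each degree. -/
def BinCx.mapObj {A B : ExCat.{u}} (G : ExFunctor A B) (M : BinCx A) : BinCx B where
  X i := G.F.obj (M.X i)
  d i := G.F.map (M.d i)
  d' i := G.F.map (M.d' i)
  d_comp_d i := by rw [← G.F.map_comp, M.d_comp_d, G.F.map_zero]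
  d'_comp_d' i := by rw [← G.F.map_comp, M.d'_comp_d', G.F.map_zero]
  bounded := by
    obtain ⟨a, b, h⟩ := M.bounded
    exact ⟨a, b, fun i hi => G.F.map_isZero (h i hi)⟩
  acyclic := M.acyclic.map G
  acyclic' := M.acyclic'.map G

/-- The functor `G` applied to a morphism of binary complexes in each degree. -/
def BinCx.mapHom {A B : ExCat.{u}} (G : ExFunctor A B) {M N : BinCx A} (φ : M ⟶ N) :
    BinCx.mapObj G M ⟶ BinCx.mapObj G N where
  f i := G.F.map (φ.f i)
  comm i := by
    change G.F.map _ ≫ G.F.map _ = G.F.map _ ≫ G.F.map _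
    rw [← G.F.map_comp, φ.comm, G.F.map_comp]
  comm' i := by
    change G.F.map _ ≫ G.F.map _ = G.F.map _ ≫ G.F.map _
    rw [← G.F.map_comp, φ.comm', G.F.map_comp]

/-- The functor `B^q A ⟶ B^q B` induced by an exact functor `A ⟶ B`. -/
def ExFunctor.bq {A B : ExCat.{u}} (G : ExFunctor A B) : ExFunctor A.bq B.bq where
  F :=
    { obj := fun (M : BinCx A) => BinCx.mapObj G M
      map := fun {M N : BinCx A} (φ : M ⟶ N) => BinCx.mapHom G φ
      map_id := fun (M : BinCx A) => BinCx.hom_ext fun i => G.F.map_id (M.X i)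
      map_comp := fun {L M N : BinCx A} (φ : L ⟶ M) (ψ : M ⟶ N) =>
        BinCx.hom_ext fun i => G.F.map_comp (φ.f i) (ψ.f i) }
  zero := ⟨fun (M N : BinCx A) => BinCx.hom_ext fun i => G.F.map_zero (M.X i) (N.X i)⟩
  map_ses := fun {L M N : BinCx A} (φ : L ⟶ M) (ψ : M ⟶ N) h i => G.map_ses (φ.f i) (ψ.f i) (h i)

/-- The iterated construction `(B^q)^n A`: bounded acyclic binary multicomplexes of
dimension `n` in `A`. -/
def ExCat.bqn (A : ExCat.{u}) : ℕ → ExCat.{u}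
  | 0 => A
  | n + 1 => ExCat.bq (ExCat.bqn A n)

/-- The functor `(B^q)^n A ⟶ (B^q)^n B` induced by an exact functor `A ⟶ B`. -/
def ExFunctor.bqn {A B : ExCat.{u}} (G : ExFunctor A B) :
    (n : ℕ) → ExFunctor (ExCat.bqn A n) (ExCat.bqn B n)
  | 0 => G
  | n + 1 => ExFunctor.bq (ExFunctor.bqn G n)

/-- The two differentials of a multicomplex in direction `k` coincide; direction `0` is that of
the outermost application of `B^q`. -/
def DiagonalIn (A : ExCat.{u}) :
    (n : ℕ) → Fin n → (ExCat.bqn A n).Obj → Prop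
  | 0, k, _ => k.elim0
  | n + 1, k, (N : BinCx (A.bqn n)) =>
      Fin.cases (N.d = N.d') (fun j => ∀ i : ℤ, DiagonalIn A n j (N.X i)) k

/-- A multicomplex is diagonal if its two differentials coincide in at least one direction. -/
def Diagonal (A : ExCat.{u}) (n : ℕ) (N : (ExCat.bqn A n).Obj) : Prop :=
  ∃ k, DiagonalIn A n k N

/-! ### Grothendieck groups and higher `K`-groups -/

/-- The relations `[Y] = [X] + [Z]`, one for each short exact sequence `0 ⟶ X ⟶ Y ⟶ Z ⟶ 0`. -/
def sesRel (A : ExCat.{u}) : AddSubgroup (FreeAbelianGroup A.Obj) :=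
  AddSubgroup.closure {x | ∃ (X Y Z : A.Obj) (f : X ⟶ Y) (g : Y ⟶ Z), A.ses f g ∧
    x = FreeAbelianGroup.of Y - (FreeAbelianGroup.of X + FreeAbelianGroup.of Z)}

/-- The Grothendieck group `K_0 A`. -/
abbrev K0 (A : ExCat.{u}) := FreeAbelianGroup A.Obj ⧸ sesRel A

/-- The class `[X]` in `K_0 A`. -/
def K0.cls {A : ExCat.{u}} (X : A.Obj) : K0 A :=
  QuotientAddGroup.mk' (sesRel A) (FreeAbelianGroup.of X)

/-- The map on `K_0` induced by an exact functor, `[X] ↦ [F X]`. -/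
def K0.map {A B : ExCat.{u}} (G : ExFunctor A B) : K0 A →+ K0 B :=
  QuotientAddGroup.map (sesRel A) (sesRel B) (FreeAbelianGroup.map G.F.obj) (by
    rw [sesRel, AddSubgroup.closure_le]
    rintro _ ⟨X, Y, Z, f, g, h, rfl⟩
    apply AddSubgroup.subset_closure
    exact ⟨_, _, _, G.F.map f, G.F.map g, G.map_ses f g h, by simp⟩)

theorem K0.map_cls {A B : ExCat.{u}} (G : ExFunctor A B) (X : A.Obj) :
    K0.map G (K0.cls X) = K0.cls (G.F.obj X) := by
  simp [K0.map, K0.cls]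

/-- The subgroup `T_A^n` of `K_0 (B^q)^n A` generated by the classes of the diagonal
multicomplexes. -/
def diagSub (A : ExCat.{u}) (n : ℕ) : AddSubgroup (K0 (ExCat.bqn A n)) :=
  AddSubgroup.closure {x | ∃ N, Diagonal A n N ∧ x = K0.cls N}

/-- The higher `K`-group `K_n A = K_0 (B^q)^n A / T_A^n`: generated by the objects of
`(B^q)^n A`, with a relation for each short exact sequence, and with the diagonal
multicomplexes set to zero. -/
abbrev Kn (A : ExCat.{u}) (n : ℕ) := K0 (ExCat.bqn A n) ⧸ diagSub A n

theorem DiagonalIn.map {A B : ExCat.{u}} (G : ExFunctor A B) :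
    ∀ (n : ℕ) (k : Fin n) (N : (ExCat.bqn A n).Obj), DiagonalIn A n k N →
      DiagonalIn B n k ((ExFunctor.bqn G n).F.obj N)
  | 0, k, _, _ => k.elim0
  | n + 1, k, N, h => by
      induction k using Fin.cases with
      | zero =>
        have h1 : BinCx.d (A := ExCat.bqn A n) N =
          BinCx.d' (A := ExCat.bqn A n) N := h
        change (fun i => (ExFunctor.bqn G n).F.map _) =
          (fun i => (ExFunctor.bqn G n).F.map _)
        rw [h1]
      | succ j => exact fun i => DiagonalIn.map G n j _ (h i)

theorem diagSub_le {A B : ExCat.{u}} (G : ExFunctor A B) (n : ℕ) :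
    diagSub A n ≤
      (diagSub B n).comap (K0.map (ExFunctor.bqn G n)) := by
  rw [diagSub, AddSubgroup.closure_le]
  rintro _ ⟨N, ⟨k, hk⟩, rfl⟩
  apply AddSubgroup.subset_closure
  exact ⟨_, ⟨k, DiagonalIn.map G n k N hk⟩, K0.map_cls _ _⟩

/-- The map on `K_n` induced by an exact functor. -/
def Kn.map {A B : ExCat.{u}} (G : ExFunctor A B) (n : ℕ) :
    Kn A n →+ Kn B n :=
  QuotientAddGroup.map _ _ (K0.map (ExFunctor.bqn G n)) (diagSub_le G n)

/-! ### Nilpotent endomorphisms -/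

/-- An object of `A` together with a nilpotent endomorphism. -/
structure NilObj (A : ExCat.{u}) where
  /-- the underlying object -/
  obj : A.Obj
  /-- the endomorphism -/
  ν : End obj
  nilpotent : ∃ k : ℕ, (ν ^ k : End obj) = (0 : obj ⟶ obj)

namespace NilObj

variable {A : ExCat.{u}}

/-- Morphisms are the morphisms of the underlying objects that commute with the endomorphisms. -/
@[ext]
structure Hom (M N : NilObj A) where
  /-- the underlying morphism -/
  hom : M.obj ⟶ N.obj
  comm : (M.ν : M.obj ⟶ M.obj) ≫ hom = hom ≫ (N.ν : N.obj ⟶ N.obj)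

instance : Category (NilObj A) where
  Hom := Hom
  id M := ⟨𝟙 _, by simp⟩
  comp φ ψ := ⟨φ.hom ≫ ψ.hom,
    by rw [← Category.assoc, φ.comm, Category.assoc, ψ.comm, Category.assoc]⟩
  id_comp φ := Hom.ext (Category.id_comp _)
  comp_id φ := Hom.ext (Category.comp_id _)
  assoc φ ψ χ := Hom.ext (Category.assoc _ _ _)

@[ext]
theorem hom_ext {M N : NilObj A} {φ ψ : M ⟶ N} (h : φ.hom = ψ.hom) : φ = ψ :=
  Hom.ext h

@[simp] theorem id_hom (M : NilObj A) : Hom.hom (𝟙 M) = 𝟙 M.obj := rfl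

@[simp] theorem comp_hom {M N P : NilObj A} (φ : M ⟶ N) (ψ : N ⟶ P) :
    Hom.hom (φ ≫ ψ) = φ.hom ≫ ψ.hom := rfl

instance : HasZeroMorphisms (NilObj A) where
  zero M N := ⟨⟨0, by simp⟩⟩
  comp_zero φ _ := hom_ext comp_zero
  zero_comp _ _ _ ψ := hom_ext zero_comp

@[simp] theorem zero_hom (M N : NilObj A) : Hom.hom (0 : M ⟶ N) = 0 := rfl

end NilObj

/-- The exact category `Nil(A)`; a sequence is short exact when the underlying sequence is. -/
def ExCat.nil (A : ExCat.{u}) : ExCat.{u} where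
  Obj := NilObj A
  cat := inferInstance
  zeroMor := inferInstance
  ses := fun {L M N : NilObj A} (φ : L ⟶ M) (ψ : M ⟶ N) => A.ses φ.hom ψ.hom

/-- The forgetful functor `Nil(A) ⟶ A`, `(P, ν) ↦ P`. -/
def forgetNil (A : ExCat.{u}) : ExFunctor A.nil A where
  F :=
    { obj := fun (M : NilObj A) => M.obj
      map := fun {M N : NilObj A} (φ : M ⟶ N) => φ.hom
      map_id := fun _ => rfl
      map_comp := fun _ _ => rfl }
  zero := ⟨fun _ _ => rfl⟩
  map_ses _ _ h := h

/-- The pair `(P, 0)` attached to `(P, ν)`. -/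
def NilObj.kill {A : ExCat.{u}} (M : NilObj A) : NilObj A where
  obj := M.obj
  ν := (0 : M.obj ⟶ M.obj)
  nilpotent := ⟨1, pow_one (M := End M.obj) _⟩

/-- The functor `Nil(A) ⟶ Nil(A)`, `(P, ν) ↦ (P, 0)`. -/
def killNil (A : ExCat.{u}) : ExFunctor A.nil A.nil where
  F :=
    { obj := fun (M : NilObj A) => M.kill
      map := fun {M N : NilObj A} (φ : M ⟶ N) =>
        (NilObj.Hom.mk (M := M.kill) (N := N.kill) φ.hom
          ((zero_comp (f := φ.hom)).trans (comp_zero (f := φ.hom)).symm))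
      map_id := fun _ => rfl
      map_comp := fun _ _ => rfl }
  zero := ⟨fun _ _ => rfl⟩
  map_ses _ _ h := h

/-- The functor `Nil(A) ⟶ Nil(B)`, `(P, ν) ↦ (G P, G ν)`, induced by an exact functor `G`. -/
def ExFunctor.nil {A B : ExCat.{u}} (G : ExFunctor A B) : ExFunctor A.nil B.nil where
  F :=
    { obj := fun (M : NilObj A) => ({
        obj := G.F.obj M.obj
        ν := G.F.mapEnd M.obj M.ν
        nilpotent := by
          obtain ⟨k, hk⟩ := M.nilpotent
          refine ⟨k, ?_⟩
          rw [← map_pow]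
          exact (congrArg (fun f => G.F.map f) hk).trans (G.F.map_zero _ _) } : NilObj B)
      map := fun {M N : NilObj A} (φ : M ⟶ N) => ({
        hom := G.F.map φ.hom
        comm := by
          change G.F.map _ ≫ G.F.map _ = G.F.map _ ≫ G.F.map _
          rw [← G.F.map_comp, ← G.F.map_comp, φ.comm] } : NilObj.Hom _ _)
      map_id := fun (M : NilObj A) => NilObj.hom_ext (G.F.map_id M.obj)
      map_comp := fun {L M N : NilObj A} (φ : L ⟶ M) (ψ : M ⟶ N) =>
        NilObj.hom_ext (G.F.map_comp φ.hom ψ.hom) }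
  zero := ⟨fun (M N : NilObj A) => NilObj.hom_ext (G.F.map_zero M.obj N.obj)⟩
  map_ses := fun {L M N : NilObj A} (φ : L ⟶ M) (ψ : M ⟶ N) h => G.map_ses φ.hom ψ.hom h

/-! ### Modules -/

/-- The full subcategory of `R`-modules with the property `P`, with the short exact sequences of
`R`-modules as exact structure. -/
def modEx (R : Type u) [CommRing R] (P : ObjectProperty (ModuleCat.{u} R)) :
    ExCat.{u} where
  Obj := P.FullSubcategory
  cat := inferInstance
  zeroMor := inferInstance
  ses := fun {L M N : P.FullSubcategory} (f : L ⟶ M) (g : M ⟶ N) =>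
    Function.Injective f.hom.hom ∧ Function.Exact f.hom.hom g.hom.hom ∧ Function.Surjective g.hom.hom

/-- Finitely generated projective modules. -/
def fgProj (R : Type u) [CommRing R] : ObjectProperty (ModuleCat.{u} R) :=
  fun M => Module.Finite R M ∧ Module.Projective R M

/-- Finitely generated free modules. -/
def fgFree (R : Type u) [CommRing R] : ObjectProperty (ModuleCat.{u} R) :=
  fun M => Module.Finite R M ∧ Module.Free R M

theorem fgFree_le_fgProj (R : Type u) [CommRing R] : fgFree R ≤ fgProj R := by
  rintro M ⟨h1, h2⟩
  exact ⟨h1, inferInstance⟩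

/-- The exact category `P(R)` of finitely generated projective `R`-modules. -/
abbrev PCat (R : Type u) [CommRing R] : ExCat.{u} := modEx R (fgProj R)

/-- The exact category `Free(R)` of finitely generated free `R`-modules. -/
abbrev FreeCat (R : Type u) [CommRing R] : ExCat.{u} := modEx R (fgFree R)

/-- The inclusion `Free(R) ⟶ P(R)`. -/
def freeIncl (R : Type u) [CommRing R] : ExFunctor (FreeCat R) (PCat R) where
  F := ObjectProperty.ιOfLE (fgFree_le_fgProj R)
  zero := ⟨fun _ _ => rfl⟩
  map_ses _ _ h := h

/-- The category `Nil(R)` of pairs `(P, ν)`, `P` finitely generated projective and `ν` nilpotent. -/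
abbrev NilCat (R : Type u) [CommRing R] : ExCat.{u} := (PCat R).nil

/-- The category `Nil(Free(R))` of pairs `(F, ν)`, `F` finitely generated free and `ν` nilpotent. -/
abbrev NilFreeCat (R : Type u) [CommRing R] : ExCat.{u} := (FreeCat R).nil

/-! ### Nil groups -/

/-- `(B^q)^n Nil(Free(R))`. -/
abbrev NilFreeCx (R : Type u) [CommRing R] (n : ℕ) := (ExCat.bqn (NilFreeCat R) n).Obj

/-- For `F` in `(B^q)^n Nil(Free(R))`, the same multicomplex with the nilpotent endomorphism
replaced by zero. -/
def zeroNu {R : Type u} [CommRing R] {n : ℕ} (F : NilFreeCx R n) : NilFreeCx R n :=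
  (ExFunctor.bqn (killNil (FreeCat R)) n).F.obj F

/-- The class in `K_0 (B^q)^n Nil(R)` of a multicomplex of `(B^q)^n Nil(Free(R))`. -/
def freeCls {R : Type u} [CommRing R] {n : ℕ} (F : NilFreeCx R n) :
    K0 (ExCat.bqn (NilCat R) n) :=
  K0.cls ((ExFunctor.bqn (freeIncl R).nil n).F.obj F)

/-- `Nil_n(R)`, the kernel of `K_n Nil(R) ⟶ K_n P(R)`. -/
def NilGrp (R : Type u) [CommRing R] (n : ℕ) : AddSubgroup (Kn (NilCat R) n) :=
  (Kn.map (forgetNil (PCat R)) n).ker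

/-- The kernel of `K_0 (B^q)^n Nil(R) ⟶ K_0 (B^q)^n P(R)`. -/
def NilTilde (R : Type u) [CommRing R] (n : ℕ) :
    AddSubgroup (K0 (ExCat.bqn (NilCat R) n)) :=
  (K0.map (ExFunctor.bqn (forgetNil (PCat R)) n)).ker

/-- The kernel of `T_{Nil(R)}^n ⟶ T_{P(R)}^n`, as a subgroup of the kernel of
`K_0 (B^q)^n Nil(R) ⟶ K_0 (B^q)^n P(R)`. -/
def TTilde (R : Type u) [CommRing R] (n : ℕ) : AddSubgroup (NilTilde R n) :=
  (diagSub (NilCat R) n).addSubgroupOf (NilTilde R n)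

end NilK

/-! The functor `P ↦ (P, 0)` is a section of the forgetful functor, and both preserve diagonal
multicomplexes. Write `kill` for the composite `(P, ν) ↦ (P, 0)`. On `K_0` the map `1 - kill`
therefore lands in the kernel of the forgetful map and is the identity there. If the class of `z`
lies in `Nil_n(R)`, then `kill z` is a combination of diagonal classes, so `z - kill z` is a lift of
the same class to `NilTilde`. This gives surjectivity of the quotient map; its kernel is `TTilde` by
definition, whence the isomorphism.

Since `K_0` is generated by classes of objects, `NilTilde` is generated by the differences `[X] -
kill [X]`. It remains to replace projective objects by free ones. It suffices that `X ⊕ M` is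
isomorphic to a multicomplex over `Nil(Free(R))` for some `M` with zero endomorphism: `kill` fixes
`[M]`, so `[M]` cancels from the difference.

Such an `M` is built by induction on the dimension. A multicomplex over `Nil(Free(R))` must have
free cycles as well as free terms, and kernels of surjections of free modules are only stably free.
Hence the induction (`IsCofinal.bq`) carries three classes: `D` (allowed complements, initially `ν =
0`), `S` (liftable objects, initially free) and `C` (initially stably free), which is closed under
extensions and kernels. One contractible diagonal complex first brings the terms, hence the cycles
of both differentials, into `C`; a second brings terms and cycles into `S`. `HasLifts.bq` and
`Fixes.bq` carry along the lifting of `S` and the invariance of `D` under `kill`. -/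

namespace NilK

/-! ### Biproducts in categories with zero morphisms. -/

/-- A bicone with the two universal properties of a biproduct is a bilimit. -/
def isBilimitMk {C : Type*} [Category C] [HasZeroMorphisms C] {P Q : C} (b : BinaryBicone P Q)
    (lift : ∀ {T : C}, (T ⟶ P) → (T ⟶ Q) → (T ⟶ b.pt))
    (lift_fst : ∀ {T : C} (f : T ⟶ P) (g : T ⟶ Q), lift f g ≫ b.fst = f)
    (lift_snd : ∀ {T : C} (f : T ⟶ P) (g : T ⟶ Q), lift f g ≫ b.snd = g)
    (hom_ext : ∀ {T : C} (f g : T ⟶ b.pt), f ≫ b.fst = g ≫ b.fst → f ≫ b.snd = g ≫ b.snd → f = g)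
    (desc : ∀ {T : C}, (P ⟶ T) → (Q ⟶ T) → (b.pt ⟶ T))
    (inl_desc : ∀ {T : C} (f : P ⟶ T) (g : Q ⟶ T), b.inl ≫ desc f g = f)
    (inr_desc : ∀ {T : C} (f : P ⟶ T) (g : Q ⟶ T), b.inr ≫ desc f g = g)
    (hom_ext' : ∀ {T : C} (f g : b.pt ⟶ T),
      b.inl ≫ f = b.inl ≫ g → b.inr ≫ f = b.inr ≫ g → f = g) : b.IsBilimit where
  isLimit := BinaryFan.isLimitMk (fun s => lift s.fst s.snd) (fun _ => lift_fst _ _)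
    (fun _ => lift_snd _ _) (fun _ _ h h' => hom_ext _ _ (h.trans (lift_fst _ _).symm)
      (h'.trans (lift_snd _ _).symm))
  isColimit := BinaryCofan.isColimitMk (fun s => desc s.inl s.inr) (fun _ => inl_desc _ _)
    (fun _ => inr_desc _ _) (fun _ _ h h' => hom_ext' _ _ (h.trans (inl_desc _ _).symm)
      (h'.trans (inr_desc _ _).symm))

section

variable {C : Type*} [Category C] [HasZeroMorphisms C] [HasBinaryBiproducts C] {X Y X' Y' : C}

theorem isZero_biprod (hX : IsZero X) (hY : IsZero Y) : IsZero (X ⊞ Y) := by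
  rw [IsZero.iff_id_eq_zero]
  exact biprod.hom_ext _ _ (hX.eq_of_tgt _ _) (hY.eq_of_tgt _ _)

theorem comp_uniqueUpToIso_hom {b : BinaryBicone X X'} (hb : b.IsBilimit) {b' : BinaryBicone Y Y'}
    (hb' : b'.IsBilimit) {f : X ⟶ Y} {g : X' ⟶ Y'} {φ : b.pt ⟶ b'.pt}
    (h : φ ≫ b'.fst = b.fst ≫ f) (h' : φ ≫ b'.snd = b.snd ≫ g) :
    φ ≫ (biprod.uniqueUpToIso _ _ hb').hom =
      (biprod.uniqueUpToIso _ _ hb).hom ≫ biprod.map f g := by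
  apply biprod.hom_ext <;> simp [h, h']

theorem inl_uniqueUpToIso_hom {b : BinaryBicone X Y} (hb : b.IsBilimit) :
    b.inl ≫ (biprod.uniqueUpToIso _ _ hb).hom = biprod.inl := by
  apply biprod.hom_ext <;> simp

end

/-- The closure properties of an exact category concerning isomorphisms, zero objects and
direct sums. -/
class ExCat.HasSums (A : ExCat.{u}) : Prop extends
    HasZeroObject A.Obj, HasBinaryBiproducts A.Obj where
  ses_of_iso : ∀ {X Y Z X' Y' Z' : A.Obj} {f : X ⟶ Y} {g : Y ⟶ Z} {f' : X' ⟶ Y'} {g' : Y' ⟶ Z'}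
    (eX : X ≅ X') (eY : Y ≅ Y') (eZ : Z ≅ Z'), f ≫ eY.hom = eX.hom ≫ f' →
    g ≫ eZ.hom = eY.hom ≫ g' → A.ses f g → A.ses f' g'
  ses_inl_snd : ∀ X Y : A.Obj, A.ses (biprod.inl : X ⟶ X ⊞ Y) (biprod.snd : X ⊞ Y ⟶ Y)
  ses_map : ∀ {X Y Z X' Y' Z' : A.Obj} {f : X ⟶ Y} {g : Y ⟶ Z} {f' : X' ⟶ Y'} {g' : Y' ⟶ Z'},
    A.ses f g → A.ses f' g' → A.ses (biprod.map f f') (biprod.map g g')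
  isZero_left : ∀ {X Y Z : A.Obj} {f : X ⟶ Y} {g : Y ⟶ Z}, A.ses f g → IsZero Y → IsZero X

open ExCat.HasSums (ses_of_iso ses_inl_snd ses_map isZero_left)

open scoped ZeroObject

/-! ### Direct sums and contractible complexes in `B^q A`. -/

section

variable {A : ExCat.{u}}

namespace BinCx

theorem isZero_of_forall {M : BinCx A} (h : ∀ i, IsZero (M.X i)) : IsZero M := by
  rw [IsZero.iff_id_eq_zero]
  exact hom_ext fun i => (h i).eq_of_src _ _

theorem isZero_X {M : BinCx A} (h : IsZero M) (i : ℤ) : IsZero (M.X i) := by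
  rw [IsZero.iff_id_eq_zero] at h ⊢
  exact congrArg (fun φ => Hom.f φ i) h

/-- The isomorphism in degree `i` of an isomorphism of binary complexes. -/
def isoX {M N : BinCx A} (e : M ≅ N) (i : ℤ) : M.X i ≅ N.X i where
  hom := e.hom.f i
  inv := e.inv.f i
  hom_inv_id := congrArg (fun φ => Hom.f φ i) e.hom_inv_id
  inv_hom_id := congrArg (fun φ => Hom.f φ i) e.inv_hom_id

end BinCx

theorem K0.cls_eq_add {X Y Z : A.Obj} {f : X ⟶ Y} {g : Y ⟶ Z} (h : A.ses f g) :
    (K0.cls Y : K0 A) = K0.cls X + K0.cls Z := by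
  rw [← sub_eq_zero]
  exact (QuotientAddGroup.eq_zero_iff _).2 (AddSubgroup.subset_closure ⟨X, Y, Z, f, g, h, rfl⟩)

variable [A.HasSums]

theorem Acyclic.biprod {X Y : ℤ → A.Obj} {d : ∀ i, X i ⟶ X (i - 1)} {d' : ∀ i, Y i ⟶ Y (i - 1)}
    (h : Acyclic A X d) (h' : Acyclic A Y d') :
    Acyclic A (fun i => X i ⊞ Y i) (fun i => biprod.map (d i) (d' i)) := by
  obtain ⟨Z, ι, p, h1, h2⟩ := h
  obtain ⟨Z', ι', p', h1', h2'⟩ := h'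
  refine ⟨fun i => Z i ⊞ Z' i, fun i => biprod.map (ι i) (ι' i), fun i => biprod.map (p i) (p' i),
    fun i => ?_, fun i => ses_map (h2 i) (h2' i)⟩
  dsimp only
  rw [h1, h1']
  ext <;> simp

namespace BinCx

/-- The direct sum of two binary complexes. -/
noncomputable def sum (M N : BinCx A) : BinCx A where
  X i := M.X i ⊞ N.X i
  d i := biprod.map (M.d i) (N.d i)
  d' i := biprod.map (M.d' i) (N.d' i)
  d_comp_d i := by ext <;> simp [M.d_comp_d, N.d_comp_d]
  d'_comp_d' i := by ext <;> simp [M.d'_comp_d', N.d'_comp_d']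
  bounded := by
    obtain ⟨a, b, h⟩ := M.bounded
    obtain ⟨a', b', h'⟩ := N.bounded
    exact ⟨min a a', max b b', fun i hi => isZero_biprod (h i (by grind)) (h' i (by grind))⟩
  acyclic := M.acyclic.biprod N.acyclic
  acyclic' := M.acyclic'.biprod N.acyclic'

/-- The direct sum of two binary complexes, with its inclusions and projections. -/
noncomputable def sumBicone (M N : BinCx A) : BinaryBicone M N where
  pt := sum M N
  fst := ⟨fun _ => biprod.fst, fun _ => by simp [sum], fun _ => by simp [sum]⟩
  snd := ⟨fun _ => biprod.snd, fun _ => by simp [sum], fun _ => by simp [sum]⟩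
  inl := ⟨fun _ => biprod.inl, fun _ => by simp [sum], fun _ => by simp [sum]⟩
  inr := ⟨fun _ => biprod.inr, fun _ => by simp [sum], fun _ => by simp [sum]⟩
  inl_fst := hom_ext fun _ => biprod.inl_fst
  inl_snd := hom_ext fun _ => biprod.inl_snd
  inr_fst := hom_ext fun _ => biprod.inr_fst
  inr_snd := hom_ext fun _ => biprod.inr_snd

/-- The degreewise direct sum is a biproduct. -/
noncomputable def sumIsBilimit (M N : BinCx A) : (sumBicone M N).IsBilimit :=
  isBilimitMk _
    (fun f g => ⟨fun i => biprod.lift (f.f i) (g.f i),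
      fun i => biprod.hom_ext _ _ (by simp [sumBicone, sum, f.comm])
        (by simp [sumBicone, sum, g.comm]),
      fun i => biprod.hom_ext _ _ (by simp [sumBicone, sum, f.comm'])
        (by simp [sumBicone, sum, g.comm'])⟩)
    (fun _ _ => hom_ext fun _ => biprod.lift_fst _ _)
    (fun _ _ => hom_ext fun _ => biprod.lift_snd _ _)
    (fun _ _ h h' => hom_ext fun i => biprod.hom_ext _ _ (congrArg (fun φ => Hom.f φ i) h)
      (congrArg (fun φ => Hom.f φ i) h'))
    (fun f g => ⟨fun i => biprod.desc (f.f i) (g.f i),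
      fun i => biprod.hom_ext' _ _ (by simp [sumBicone, sum, f.comm])
        (by simp [sumBicone, sum, g.comm]),
      fun i => biprod.hom_ext' _ _ (by simp [sumBicone, sum, f.comm'])
        (by simp [sumBicone, sum, g.comm'])⟩)
    (fun _ _ => hom_ext fun _ => biprod.inl_desc _ _)
    (fun _ _ => hom_ext fun _ => biprod.inr_desc _ _)
    (fun _ _ h h' => hom_ext fun i => biprod.hom_ext' _ _ (congrArg (fun φ => Hom.f φ i) h)
      (congrArg (fun φ => Hom.f φ i) h'))

instance : HasBinaryBiproducts (BinCx A) :=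
  ⟨fun M N => .mk ⟨sumBicone M N, sumIsBilimit M N⟩⟩

/-- The degreewise direct sum is isomorphic to the biproduct. -/
noncomputable def sumIso (M N : BinCx A) : (sumBicone M N).pt ≅ M ⊞ N :=
  biprod.uniqueUpToIso M N (sumIsBilimit M N)

/-- The contractible binary complex with `W i ⊞ W (i - 1)` in degree `i`, whose two differentials
coincide. -/
noncomputable def cone (W : ℤ → A.Obj) (hW : ∃ a b : ℤ, ∀ i, (i < a ∨ b < i) → IsZero (W i)) :
    BinCx A :=
  have acyc : Acyclic A (fun i => W i ⊞ W (i - 1)) (fun _ => biprod.snd ≫ biprod.inl) :=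
    ⟨W, fun _ => biprod.inl, fun _ => biprod.snd, fun _ => rfl, fun _ => ses_inl_snd _ _⟩
  { X := fun i => W i ⊞ W (i - 1)
    d := fun _ => biprod.snd ≫ biprod.inl
    d' := fun _ => biprod.snd ≫ biprod.inl
    d_comp_d := by simp
    d'_comp_d' := by simp
    bounded := by
      obtain ⟨a, b, h⟩ := hW
      -- Degree `i` also contains `W (i - 1)`, so the support reaches one degree higher than that of
      -- `W`.
      exact ⟨a, b + 1, fun i hi => isZero_biprod (h i (by grind)) (h (i - 1) (by grind))⟩
    acyclic := acyc
    acyclic' := acyc }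

instance : HasZeroObject (BinCx A) :=
  ⟨cone (fun _ => (0 : A.Obj)) ⟨0, 0, fun _ _ => isZero_zero _⟩,
    isZero_of_forall fun _ => isZero_biprod (isZero_zero _) (isZero_zero _)⟩

theorem ses_of_iso {X Y Z X' Y' Z' : BinCx A} {f : X ⟶ Y} {g : Y ⟶ Z} {f' : X' ⟶ Y'}
    {g' : Y' ⟶ Z'} (eX : X ≅ X') (eY : Y ≅ Y') (eZ : Z ≅ Z') (hf : f ≫ eY.hom = eX.hom ≫ f')
    (hg : g ≫ eZ.hom = eY.hom ≫ g') (h : ∀ i, A.ses (f.f i) (g.f i)) (i : ℤ) :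
    A.ses (f'.f i) (g'.f i) :=
  ExCat.HasSums.ses_of_iso (isoX eX i) (isoX eY i) (isoX eZ i) (congrArg (fun φ => Hom.f φ i) hf)
    (congrArg (fun φ => Hom.f φ i) hg) (h i)

theorem ses_inl_snd (M N : BinCx A) (i : ℤ) :
    A.ses ((biprod.inl : M ⟶ M ⊞ N).f i) ((biprod.snd : M ⊞ N ⟶ N).f i) :=
  ses_of_iso (f := (sumBicone M N).inl) (g := (sumBicone M N).snd) (Iso.refl _) (sumIso M N)
    (Iso.refl _) ((inl_uniqueUpToIso_hom _).trans (Category.id_comp _).symm)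
    ((Category.comp_id _).trans (biprod.lift_snd _ _).symm) (fun _ => ExCat.HasSums.ses_inl_snd _ _) i

/-- The degreewise direct sum of two morphisms. -/
noncomputable def sumMap {M N M' N' : BinCx A} (f : M ⟶ N) (g : M' ⟶ N') :
    (sumBicone M M').pt ⟶ (sumBicone N N').pt where
  f i := biprod.map (f.f i) (g.f i)
  comm i := biprod.hom_ext _ _ (by simp [sumBicone, sum, f.comm])
    (by simp [sumBicone, sum, g.comm])
  comm' i := biprod.hom_ext _ _ (by simp [sumBicone, sum, f.comm'])
    (by simp [sumBicone, sum, g.comm'])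

theorem ses_map {X Y Z X' Y' Z' : BinCx A} {f : X ⟶ Y} {g : Y ⟶ Z} {f' : X' ⟶ Y'} {g' : Y' ⟶ Z'}
    (h : ∀ i, A.ses (f.f i) (g.f i)) (h' : ∀ i, A.ses (f'.f i) (g'.f i)) (i : ℤ) :
    A.ses ((biprod.map f f').f i) ((biprod.map g g').f i) :=
  ses_of_iso (f := sumMap f f') (g := sumMap g g') (sumIso _ _) (sumIso _ _) (sumIso _ _)
    (comp_uniqueUpToIso_hom _ _ (hom_ext fun _ => biprod.map_fst _ _)
      (hom_ext fun _ => biprod.map_snd _ _))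
    (comp_uniqueUpToIso_hom _ _ (hom_ext fun _ => biprod.map_fst _ _)
      (hom_ext fun _ => biprod.map_snd _ _)) (fun i => ExCat.HasSums.ses_map (h i) (h' i)) i

end BinCx

instance : A.bq.HasSums where
  zero := (inferInstance : HasZeroObject (BinCx A)).zero
  has_binary_biproduct := (inferInstance : HasBinaryBiproducts (BinCx A)).has_binary_biproduct
  ses_of_iso := fun eX eY eZ hf hg h => BinCx.ses_of_iso (A := A) eX eY eZ hf hg h
  ses_inl_snd := BinCx.ses_inl_snd (A := A)
  ses_map := BinCx.ses_map (A := A)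
  isZero_left := fun h hY => BinCx.isZero_of_forall fun i => isZero_left (h i) (BinCx.isZero_X hY i)

theorem K0.cls_biprod (X Y : A.Obj) : (K0.cls (X ⊞ Y) : K0 A) = K0.cls X + K0.cls Y :=
  K0.cls_eq_add (ses_inl_snd X Y)

/-- Precomposing the split inclusion of `Y` into `Y ⊞ Y` with `e` gives `[Y ⊞ Y] = [X] + [Y]`;
comparison with the split sequence cancels one `[Y]`. -/
theorem K0.cls_congr {X Y : A.Obj} (e : X ≅ Y) : (K0.cls X : K0 A) = K0.cls Y := by
  have h : A.ses (e.hom ≫ (biprod.inl : Y ⟶ Y ⊞ Y)) (biprod.snd : Y ⊞ Y ⟶ Y) :=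
    ses_of_iso e.symm (Iso.refl _) (Iso.refl _) (by simp) (by simp) (ses_inl_snd Y Y)
  exact add_right_cancel ((K0.cls_eq_add h).symm.trans (K0.cls_biprod Y Y))

end

/-! ### Cofinality and its passage from `A` to `B^q A`. -/

/-- The objects with property `S` are cofinal in `A`, with complements among the objects with
property `D`; the objects with property `C` are those which have property `S` stably. -/
structure IsCofinal (A : ExCat.{u}) [A.HasSums] (D C S : ObjectProperty A.Obj) : Prop where
  D_of_iso : ∀ {X Y : A.Obj}, (X ≅ Y) → D X → D Y
  C_of_iso : ∀ {X Y : A.Obj}, (X ≅ Y) → C X → C Y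
  S_of_iso : ∀ {X Y : A.Obj}, (X ≅ Y) → S X → S Y
  D_of_isZero : ∀ {X : A.Obj}, IsZero X → D X
  C_of_isZero : ∀ {X : A.Obj}, IsZero X → C X
  S_of_isZero : ∀ {X : A.Obj}, IsZero X → S X
  D_biprod : ∀ {X Y : A.Obj}, D X → D Y → D (X ⊞ Y)
  S_biprod : ∀ {X Y : A.Obj}, S X → S Y → S (X ⊞ Y)
  C_middle : ∀ {X Y Z : A.Obj} {f : X ⟶ Y} {g : Y ⟶ Z}, A.ses f g → C X → C Z → C Y
  C_left : ∀ {X Y Z : A.Obj} {f : X ⟶ Y} {g : Y ⟶ Z}, A.ses f g → C Y → C Z → C X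
  exists_compl : ∀ X : A.Obj, ∃ Y, D Y ∧ C (X ⊞ Y)
  exists_S : ∀ {X : A.Obj}, C X → ∃ L, D L ∧ S L ∧ S (X ⊞ L)

/-- An acyclic differential all of whose cycles have property `S`. -/
def AcyclicIn (A : ExCat.{u}) (S : ObjectProperty A.Obj) (X : ℤ → A.Obj)
    (d : ∀ i, X i ⟶ X (i - 1)) : Prop :=
  ∃ (Z : ℤ → A.Obj) (ι : ∀ i, Z i ⟶ X i) (p : ∀ i, X i ⟶ Z (i - 1)),
    (∀ i, d i = p i ≫ ι (i - 1)) ∧ (∀ i, A.ses (ι i) (p i)) ∧ ∀ i, S (Z i)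

namespace BinCx

/-- The binary complexes whose objects have property `P`. -/
def degreewise {A : ExCat.{u}} (P : ObjectProperty A.Obj) : ObjectProperty (BinCx A) :=
  fun M => ∀ i, P (M.X i)

/-- The binary complexes whose objects, and whose cycles for both differentials, have
property `S`. -/
def acyclicIn {A : ExCat.{u}} (S : ObjectProperty A.Obj) : ObjectProperty (BinCx A) :=
  fun M => (∀ i, S (M.X i)) ∧ AcyclicIn A S M.X M.d ∧ AcyclicIn A S M.X M.d'

end BinCx

section

variable {A : ExCat.{u}} [A.HasSums]

theorem AcyclicIn.of_iso {S : ObjectProperty A.Obj} {X Y : ℤ → A.Obj} {d : ∀ i, X i ⟶ X (i - 1)}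
    {d' : ∀ i, Y i ⟶ Y (i - 1)} (e : ∀ i, X i ≅ Y i)
    (he : ∀ i, d i ≫ (e (i - 1)).hom = (e i).hom ≫ d' i) (h : AcyclicIn A S X d) :
    AcyclicIn A S Y d' := by
  obtain ⟨Z, ι, p, h1, h2, h3⟩ := h
  refine ⟨Z, fun i => ι i ≫ (e i).hom, fun i => (e i).inv ≫ p i, fun i => ?_, fun i => ?_, h3⟩
  · rw [← cancel_epi (e i).hom, ← he, h1]
    simp
  · exact ses_of_iso (Iso.refl _) (e i) (Iso.refl _) (by simp) (by simp) (h2 i)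

/-- Adding a contractible complex to an acyclic one adds its defining objects to the cycles. -/
theorem AcyclicIn.biprod_cone {S : ObjectProperty A.Obj} {X Z W : ℤ → A.Obj}
    {d : ∀ i, X i ⟶ X (i - 1)} {ι : ∀ i, Z i ⟶ X i} {p : ∀ i, X i ⟶ Z (i - 1)}
    (h1 : ∀ i, d i = p i ≫ ι (i - 1)) (h2 : ∀ i, A.ses (ι i) (p i)) (h3 : ∀ i, S (Z i ⊞ W i)) :
    AcyclicIn A S (fun i => X i ⊞ (W i ⊞ W (i - 1)))
      (fun i => biprod.map (d i) (biprod.snd ≫ biprod.inl)) := by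
  refine ⟨fun i => Z i ⊞ W i, fun i => biprod.map (ι i) biprod.inl,
    fun i => biprod.map (p i) biprod.snd, fun i => ?_,
    fun i => ses_map (h2 i) (ses_inl_snd _ _), h3⟩
  dsimp only
  rw [h1]
  apply biprod.hom_ext <;> simp

namespace IsCofinal

variable {D C S : ObjectProperty A.Obj} (h : IsCofinal A D C S)

include h

/-- Below the support the cycles vanish, and `Z (i + 1)` is the kernel of `X (i + 1) ⟶ Z i`, so
closure of `C` under kernels propagates upwards. -/
theorem C_cycles {X Z : ℤ → A.Obj} {ι : ∀ i, Z i ⟶ X i} {p : ∀ i, X i ⟶ Z (i - 1)}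
    (hX : ∃ a b : ℤ, ∀ i, (i < a ∨ b < i) → IsZero (X i)) (hs : ∀ i, A.ses (ι i) (p i))
    (hC : ∀ i, C (X i)) (i : ℤ) : C (Z i) := by
  obtain ⟨a, b, hab⟩ := hX
  have low : ∀ i < a, C (Z i) := fun i hi =>
    h.C_of_isZero (isZero_left (hs i) (hab i (.inl hi)))
  rcases lt_or_ge i (a - 1) with hi | hi
  · exact low i (by lia)
  induction i, hi using Int.leInduction with
  | base => exact low _ (by lia)
  | succ i _ ih => exact h.C_left (hs (i + 1)) (hC _) (by rwa [add_sub_cancel_right])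

theorem S_biprod_right {X L L' : A.Obj} (hX : S (X ⊞ L)) (hL : S L') : S (X ⊞ (L ⊞ L')) :=
  h.S_of_iso (biprod.associator _ _ _) (h.S_biprod hX hL)

theorem S_biprod_left {X L L' : A.Obj} (hX : S (X ⊞ L)) (hL : S L') : S (X ⊞ (L' ⊞ L)) :=
  h.S_of_iso (biprod.mapIso (Iso.refl X) (biprod.braiding L L')) (h.S_biprod_right hX hL)

/-- The sum of the three separate complements works for all three objects, because each complement
itself has property `S` and does no harm to the others. -/
theorem exists_S₃ {X Y Z : A.Obj} (hX : C X) (hY : C Y) (hZ : C Z) :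
    ∃ W, D W ∧ S W ∧ S (X ⊞ W) ∧ S (Y ⊞ W) ∧ S (Z ⊞ W) := by
  obtain ⟨L, hD, hS, hL⟩ := h.exists_S hX
  obtain ⟨L', hD', hS', hL'⟩ := h.exists_S hY
  obtain ⟨L'', hD'', hS'', hL''⟩ := h.exists_S hZ
  exact ⟨(L ⊞ L') ⊞ L'', h.D_biprod (h.D_biprod hD hD') hD'', h.S_biprod (h.S_biprod hS hS') hS'',
    h.S_biprod_right (h.S_biprod_right hL hS') hS'',
    h.S_biprod_right (h.S_biprod_left hL' hS) hS'', h.S_biprod_left hL'' (h.S_biprod hS hS')⟩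

theorem acyclicIn_of_iso {M N : BinCx A} (e : M ≅ N) (hM : BinCx.acyclicIn S M) :
    BinCx.acyclicIn S N :=
  ⟨fun i => h.S_of_iso (BinCx.isoX e i) (hM.1 i),
    hM.2.1.of_iso (BinCx.isoX e) fun i => e.hom.comm i,
    hM.2.2.of_iso (BinCx.isoX e) fun i => e.hom.comm' i⟩

theorem acyclicIn_biprod {M N : BinCx A} (hM : BinCx.acyclicIn S M) (hN : BinCx.acyclicIn S N) :
    BinCx.acyclicIn S (M ⊞ N) := by
  have key : ∀ {X Y : ℤ → A.Obj} {d : ∀ i, X i ⟶ X (i - 1)} {d' : ∀ i, Y i ⟶ Y (i - 1)},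
      AcyclicIn A S X d → AcyclicIn A S Y d' →
      AcyclicIn A S (fun i => X i ⊞ Y i) (fun i => biprod.map (d i) (d' i)) := by
    rintro X Y d d' ⟨Z, ι, p, h1, h2, h3⟩ ⟨Z', ι', p', h1', h2', h3'⟩
    refine ⟨fun i => Z i ⊞ Z' i, fun i => biprod.map (ι i) (ι' i),
      fun i => biprod.map (p i) (p' i), fun i => ?_, fun i => ses_map (h2 i) (h2' i),
      fun i => h.S_biprod (h3 i) (h3' i)⟩
    dsimp only
    rw [h1, h1']
    apply biprod.hom_ext <;> simp
  exact h.acyclicIn_of_iso (BinCx.sumIso M N)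
    ⟨fun i => h.S_biprod (hM.1 i) (hN.1 i), key hM.2.1 hN.2.1, key hM.2.2 hN.2.2⟩

/-- Complement the cycles of the first differential rather than the terms: `M.X i ⊞ (Q i ⊞ Q (i -
1))` is an extension of `Z (i - 1) ⊞ Q (i - 1)` by `Z i ⊞ Q i`, so it has property `C`. The second
differential plays no role, as only the terms matter here. -/
theorem degreewise_exists_compl (M : BinCx A) :
    ∃ N, BinCx.degreewise D N ∧ BinCx.degreewise C (M ⊞ N) := by
  obtain ⟨a, b, hab⟩ := M.bounded
  obtain ⟨Z, ι, p, -, hs⟩ := M.acyclic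
  have : ∀ i, ∃ Q, D Q ∧ C (Z i ⊞ Q) ∧ (IsZero (M.X i) → IsZero Q) := fun i => by
    -- Taking the zero complement wherever `M.X i` vanishes keeps the cone on `Q` bounded.
    by_cases hi : IsZero (M.X i)
    · exact ⟨0, h.D_of_isZero (isZero_zero _),
        h.C_of_isZero (isZero_biprod (isZero_left (hs i) hi) (isZero_zero _)),
        fun _ => isZero_zero _⟩
    · obtain ⟨Q, hD, hC⟩ := h.exists_compl (Z i)
      exact ⟨Q, hD, hC, fun hi' => absurd hi' hi⟩
  choose Q hD hC h0 using this
  refine ⟨BinCx.cone Q ⟨a, b, fun i hi => h0 i (hab i hi)⟩, fun i => h.D_biprod (hD _) (hD _),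
    fun i => h.C_of_iso (BinCx.isoX (BinCx.sumIso _ _) i) ?_⟩
  exact h.C_middle (ses_map (hs i) (ses_inl_snd (Q i) (Q (i - 1)))) (hC i) (hC (i - 1))

theorem acyclicIn_cone {W : ℤ → A.Obj} (hW : ∃ a b : ℤ, ∀ i, (i < a ∨ b < i) → IsZero (W i))
    (hS : ∀ i, S (W i)) : BinCx.acyclicIn S (BinCx.cone W hW) :=
  have acyc : AcyclicIn A S (fun i => W i ⊞ W (i - 1)) (fun _ => biprod.snd ≫ biprod.inl) :=
    ⟨W, fun _ => biprod.inl, fun _ => biprod.snd, fun _ => rfl, fun _ => ses_inl_snd _ _, hS⟩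
  ⟨fun _ => h.S_biprod (hS _) (hS _), acyc, acyc⟩

/-- The cone on `W` adds `W i` to the cycles of both differentials, so a single `W i` must
complement the term and both cycle objects in degree `i`. All three have property `C` by `C_cycles`,
and `exists_S₃` applies. -/
theorem exists_acyclicIn {M : BinCx A} (hM : BinCx.degreewise C M) :
    ∃ L, BinCx.degreewise D L ∧ BinCx.acyclicIn S L ∧ BinCx.acyclicIn S (M ⊞ L) := by
  obtain ⟨Z, ι, p, hd, hs⟩ := M.acyclic
  obtain ⟨Z', ι', p', hd', hs'⟩ := M.acyclic'
  have : ∀ i, ∃ W, D W ∧ S W ∧ S (M.X i ⊞ W) ∧ S (Z i ⊞ W) ∧ S (Z' i ⊞ W) ∧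
      (IsZero (M.X i) → IsZero W) := fun i => by
    by_cases hi : IsZero (M.X i)
    · exact ⟨0, h.D_of_isZero (isZero_zero _), h.S_of_isZero (isZero_zero _),
        h.S_of_isZero (isZero_biprod hi (isZero_zero _)),
        h.S_of_isZero (isZero_biprod (isZero_left (hs i) hi) (isZero_zero _)),
        h.S_of_isZero (isZero_biprod (isZero_left (hs' i) hi) (isZero_zero _)),
        fun _ => isZero_zero _⟩
    · obtain ⟨W, h1, h2, h3, h4, h5⟩ := h.exists_S₃ (hM i) (h.C_cycles M.bounded hs hM i)
        (h.C_cycles M.bounded hs' hM i)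
      exact ⟨W, h1, h2, h3, h4, h5, fun hi' => absurd hi' hi⟩
  choose W hD hS hX hZ hZ' h0 using this
  obtain ⟨a, b, hab⟩ := M.bounded
  refine ⟨BinCx.cone W ⟨a, b, fun i hi => h0 i (hab i hi)⟩, fun i => h.D_biprod (hD _) (hD _),
    h.acyclicIn_cone _ hS, h.acyclicIn_of_iso (BinCx.sumIso _ _)
      ⟨fun i => h.S_biprod_right (hX i) (hS _), AcyclicIn.biprod_cone hd hs hZ,
        AcyclicIn.biprod_cone hd' hs' hZ'⟩⟩

/-- For `D` and `C` a degreewise condition is enough, `C` being inherited by cycles. `S` need not be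
inherited, so it is imposed on the cycles too. -/
theorem bq : IsCofinal A.bq (BinCx.degreewise D) (BinCx.degreewise C) (BinCx.acyclicIn S) where
  D_of_iso e hX i := h.D_of_iso (BinCx.isoX e i) (hX i)
  C_of_iso e hX i := h.C_of_iso (BinCx.isoX e i) (hX i)
  S_of_iso e hX := h.acyclicIn_of_iso e hX
  D_of_isZero hX i := h.D_of_isZero (BinCx.isZero_X hX i)
  C_of_isZero hX i := h.C_of_isZero (BinCx.isZero_X hX i)
  S_of_isZero hX := h.acyclicIn_of_iso
    ((BinCx.isZero_of_forall fun _ => isZero_biprod (isZero_zero _) (isZero_zero _)).iso hX)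
    (h.acyclicIn_cone (W := fun _ => 0) ⟨0, 0, fun _ _ => isZero_zero _⟩ fun _ =>
      h.S_of_isZero (isZero_zero _))
  D_biprod hX hY i := h.D_of_iso (BinCx.isoX (BinCx.sumIso _ _) i) (h.D_biprod (hX i) (hY i))
  S_biprod hX hY := h.acyclicIn_biprod hX hY
  C_middle hs hX hZ i := h.C_middle (hs i) (hX i) (hZ i)
  C_left hs hY hZ i := h.C_left (hs i) (hY i) (hZ i)
  exists_compl := h.degreewise_exists_compl
  exists_S := h.exists_acyclicIn

end IsCofinal

end

/-! ### Lifting along a full embedding, and functors fixing the complements. -/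

/-- `G` is fully faithful, detects short exact sequences, and its essential image contains the
objects with property `S`. -/
structure HasLifts {B A : ExCat.{u}} (G : ExFunctor B A) (S : ObjectProperty A.Obj) : Prop where
  full : G.F.Full
  faithful : G.F.Faithful
  reflects : ∀ {X Y Z : B.Obj} (f : X ⟶ Y) (g : Y ⟶ Z),
    A.ses (G.F.map f) (G.F.map g) → B.ses f g
  exists_iso : ∀ {X : A.Obj}, S X → ∃ Y, Nonempty (G.F.obj Y ≅ X)

/-- `T` is naturally isomorphic to the identity on the objects with property `D`. -/
def Fixes {A : ExCat.{u}} (T : ExFunctor A A) (D : ObjectProperty A.Obj) : Prop :=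
  ∃ κ : ∀ X, D X → (T.F.obj X ≅ X), ∀ (X Y : A.Obj) (hX : D X) (hY : D Y) (f : X ⟶ Y),
    T.F.map f ≫ (κ Y hY).hom = (κ X hX).hom ≫ f

/-- Isomorphisms in all degrees which commute with the differentials form an isomorphism. -/
def BinCx.isoMk {A : ExCat.{u}} {M N : BinCx A} (e : ∀ i, M.X i ≅ N.X i)
    (h : ∀ i, M.d i ≫ (e (i - 1)).hom = (e i).hom ≫ N.d i)
    (h' : ∀ i, M.d' i ≫ (e (i - 1)).hom = (e i).hom ≫ N.d' i) : M ≅ N where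
  hom := ⟨fun i => (e i).hom, h, h'⟩
  inv := ⟨fun i => (e i).inv,
    fun i => by rw [← cancel_epi (e i).hom, ← reassoc_of% (h i)]; simp,
    fun i => by rw [← cancel_epi (e i).hom, ← reassoc_of% (h' i)]; simp⟩
  hom_inv_id := BinCx.hom_ext fun i => (e i).hom_inv_id
  inv_hom_id := BinCx.hom_ext fun i => (e i).inv_hom_id

/-- Naturality of `κ`, applied to the differentials, makes the degreewise isomorphisms into one of
binary complexes; this is why `Fixes` demands more than isomorphic objects. -/
theorem Fixes.bq {A : ExCat.{u}} {T : ExFunctor A A} {D : ObjectProperty A.Obj} (h : Fixes T D) :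
    Fixes T.bq (BinCx.degreewise D) := by
  obtain ⟨κ, hκ⟩ := h
  exact ⟨fun (M : BinCx A) hM => BinCx.isoMk (M := BinCx.mapObj T M) (fun i => κ _ (hM i))
      (fun i => hκ _ _ _ _ _) fun i => hκ _ _ _ _ _,
    fun (M N : BinCx A) hM hN f => BinCx.hom_ext fun i => hκ _ _ (hM i) (hN i) (f.f i)⟩

/-- Acyclicity over `B` needs cycles in `B`: these exist because the cycles over `A` have property
`S`, and the factorisation lifts by full faithfulness. -/
theorem Acyclic.of_acyclicIn {B A : ExCat.{u}} [A.HasSums] {G : ExFunctor B A}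
    {S : ObjectProperty A.Obj} (h : HasLifts G S) {X : ℤ → A.Obj} {d : ∀ i, X i ⟶ X (i - 1)}
    (hd : AcyclicIn A S X d) {Y : ℤ → B.Obj} (e : ∀ i, G.F.obj (Y i) ≅ X i)
    {d' : ∀ i, Y i ⟶ Y (i - 1)}
    (hd' : ∀ i, G.F.map (d' i) = (e i).hom ≫ d i ≫ (e (i - 1)).inv) : Acyclic B Y d' := by
  obtain ⟨Z, ι, p, h1, h2, h3⟩ := hd
  have := h.full
  have := h.faithful
  choose Z' hZ' using fun i => h.exists_iso (h3 i)
  have e' := fun i => (hZ' i).some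
  refine ⟨Z', fun i => G.F.preimage ((e' i).hom ≫ ι i ≫ (e i).inv),
    fun i => G.F.preimage ((e i).hom ≫ p i ≫ (e' (i - 1)).inv), fun i => ?_, fun i => ?_⟩
  · apply G.F.map_injective
    simp [hd', h1]
  · apply h.reflects
    exact ses_of_iso (e' i).symm (e i).symm (e' (i - 1)).symm (by simp) (by simp) (h2 i)

theorem HasLifts.bq {B A : ExCat.{u}} [A.HasSums] {G : ExFunctor B A} {S : ObjectProperty A.Obj}
    (h : HasLifts G S) : HasLifts G.bq (BinCx.acyclicIn S) := by
  have := h.full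
  have := h.faithful
  constructor
  · refine ⟨fun {M N : BinCx B} (f : BinCx.mapObj G M ⟶ BinCx.mapObj G N) => ?_⟩
    have hc (i) : G.F.map (M.d i) ≫ f.f (i - 1) = f.f i ≫ G.F.map (N.d i) := f.comm i
    have hc' (i) : G.F.map (M.d' i) ≫ f.f (i - 1) = f.f i ≫ G.F.map (N.d' i) := f.comm' i
    choose g hg using fun i =>
      G.F.map_surjective (f.f i : G.F.obj (M.X i) ⟶ G.F.obj (N.X i))
    refine ⟨(⟨g, fun i => G.F.map_injective ?_, fun i => G.F.map_injective ?_⟩ : BinCx.Hom M N),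
      BinCx.hom_ext hg⟩
    · rw [G.F.map_comp, G.F.map_comp, hg, hg]
      exact hc i
    · rw [G.F.map_comp, G.F.map_comp, hg, hg]
      exact hc' i
  · exact ⟨fun {M N : BinCx B} (f g : M ⟶ N) hfg => BinCx.hom_ext fun i =>
      G.F.map_injective (congrArg (fun φ : BinCx.mapObj G M ⟶ BinCx.mapObj G N => φ.f i) hfg)⟩
  · exact fun f g hfg i => h.reflects _ _ (hfg i)
  · rintro (X : BinCx A) ⟨h1, h2, h3⟩
    choose Y hY using fun i => h.exists_iso (h1 i)
    have e := fun i => (hY i).some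
    let N : BinCx B :=
      { X := Y
        d := fun i => G.F.preimage ((e i).hom ≫ X.d i ≫ (e (i - 1)).inv)
        d' := fun i => G.F.preimage ((e i).hom ≫ X.d' i ≫ (e (i - 1)).inv)
        d_comp_d := fun i => G.F.map_injective (by simp [reassoc_of% (X.d_comp_d i)])
        d'_comp_d' := fun i => G.F.map_injective (by simp [reassoc_of% (X.d'_comp_d' i)])
        bounded := by
          obtain ⟨a, b, hab⟩ := X.bounded
          refine ⟨a, b, fun i hi => (IsZero.iff_id_eq_zero _).2 (G.F.map_injective ?_)⟩
          exact ((hab i hi).of_iso (e i)).eq_of_src _ _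
        acyclic := .of_acyclicIn h h2 e fun i => by simp
        acyclic' := .of_acyclicIn h h3 e fun i => by simp }
    refine ⟨N, ⟨BinCx.isoMk (M := BinCx.mapObj G N) e (fun i => ?_) fun i => ?_⟩⟩
    · simp [BinCx.mapObj, N]
    · simp [BinCx.mapObj, N]

instance ExCat.bqn_hasSums (A : ExCat.{u}) [h : A.HasSums] : ∀ n, (A.bqn n).HasSums
  | 0 => h
  | n + 1 =>
    have := bqn_hasSums A n
    (inferInstance : (A.bqn n).bq.HasSums)

theorem IsCofinal.bqn {B A : ExCat.{u}} [A.HasSums] {G : ExFunctor B A} {T : ExFunctor A A}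
    {D C S : ObjectProperty A.Obj} (h : IsCofinal A D C S) (hG : HasLifts G S) (hT : Fixes T D) :
    ∀ n, ∃ D' C' S' : ObjectProperty (A.bqn n).Obj,
      IsCofinal (A.bqn n) D' C' S' ∧ HasLifts (G.bqn n) S' ∧ Fixes (T.bqn n) D'
  | 0 => ⟨D, C, S, h, hG, hT⟩
  | n + 1 =>
    have ⟨_, _, _, h1, h2, h3⟩ := h.bqn hG hT n
    ⟨_, _, _, h1.bq, h2.bq, h3.bq⟩

/-- Every object of `(B^q)^n A` becomes isomorphic to an object in the image of `(B^q)^n B` after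
adding an object which is fixed by `T`. -/
theorem IsCofinal.exists_cls_eq_add {B A : ExCat.{u}} [A.HasSums] {G : ExFunctor B A}
    {T : ExFunctor A A} {D C S : ObjectProperty A.Obj} (h : IsCofinal A D C S)
    (hG : HasLifts G S) (hT : Fixes T D) (n : ℕ) (X : (A.bqn n).Obj) :
    ∃ (Y : (B.bqn n).Obj) (c : K0 (A.bqn n)), K0.map (T.bqn n) c = c ∧
      K0.cls ((G.bqn n).F.obj Y) = K0.cls X + c := by
  obtain ⟨D', C', S', h', hG', κ, -⟩ := h.bqn hG hT n
  -- `M` moves `X` into `C'` and `L` then moves `X ⊞ M` into `S'`. Both complements lie in `D'`, so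
  -- `T` fixes their classes.
  obtain ⟨M, hM, hC⟩ := h'.exists_compl X
  obtain ⟨L, hL, -, hS⟩ := h'.exists_S hC
  obtain ⟨Y, ⟨e⟩⟩ := hG'.exists_iso hS
  refine ⟨Y, K0.cls M + K0.cls L, ?_, ?_⟩
  · rw [map_add, K0.map_cls, K0.map_cls, K0.cls_congr (κ M hM), K0.cls_congr (κ L hL)]
  · rw [K0.cls_congr e, K0.cls_biprod, K0.cls_biprod, add_assoc]

/-! ### Stably free modules. -/

section

variable (R : Type u) [CommRing R]

/-- `M ⊕ F` is free for some finitely generated free module `F`. -/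
def StablyFree (M : Type u) [AddCommGroup M] [Module R M] : Prop :=
  ∃ (F : Type u) (_ : AddCommGroup F) (_ : Module R F),
    Module.Finite R F ∧ Module.Free R F ∧ Module.Free R (M × F)

variable {R}

section

variable {X Y Z : Type u} [AddCommGroup X] [Module R X] [AddCommGroup Y] [Module R Y]
  [AddCommGroup Z] [Module R Z]

variable (R X) in
theorem StablyFree.of_free [Module.Free R X] : StablyFree R X :=
  ⟨PUnit, inferInstance, inferInstance, inferInstance, inferInstance, inferInstance⟩

theorem StablyFree.of_equiv (e : X ≃ₗ[R] Y) (h : StablyFree R X) : StablyFree R Y := by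
  obtain ⟨F, _, _, h1, h2, h3⟩ := h
  exact ⟨F, _, _, h1, h2, .of_equiv (e.prodCongr (.refl R F))⟩

theorem StablyFree.prod (hX : StablyFree R X) (hZ : StablyFree R Z) : StablyFree R (X × Z) := by
  obtain ⟨F, _, _, _, _, _⟩ := hX
  obtain ⟨F', _, _, _, _, _⟩ := hZ
  exact ⟨F × F', _, _, inferInstance, inferInstance,
    .of_equiv (LinearEquiv.prodProdProdComm R X F Z F')⟩

/-- If `X ⊕ Z ⊕ F` and `Z ⊕ F'` are free, then `Z ⊕ F' ⊕ F` is a free complement of `X`: the total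
is `(X ⊕ Z ⊕ F) ⊕ F'`. Finiteness of `Z` keeps this complement finitely generated. -/
theorem StablyFree.left_of_prod [Module.Finite R Z] (h : StablyFree R (X × Z))
    (hZ : StablyFree R Z) : StablyFree R X := by
  obtain ⟨F, _, _, _, _, _⟩ := h
  obtain ⟨F', _, _, _, _, _⟩ := hZ
  refine ⟨(Z × F') × F, inferInstance, inferInstance, inferInstance, inferInstance, ?_⟩
  exact .of_equiv <| (LinearEquiv.prodAssoc R (X × Z) F F').trans (((LinearEquiv.refl R (X × Z)).prodCongr
    (LinearEquiv.prodComm R F F')).trans ((LinearEquiv.prodAssoc R X Z (F' × F)).trans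
      ((LinearEquiv.refl R X).prodCongr (LinearEquiv.prodAssoc R Z F' F).symm)))

theorem nonempty_equiv_prod [Module.Projective R Z] {f : X →ₗ[R] Y} {g : Y →ₗ[R] Z}
    (hf : Function.Injective f) (h : Function.Exact f g) (hg : Function.Surjective g) :
    Nonempty (Y ≃ₗ[R] X × Z) := by
  obtain ⟨l, hl⟩ := Module.projective_lifting_property g .id hg
  exact ⟨(h.splitSurjectiveEquiv hf ⟨l, hl⟩).1⟩

variable (R X) in
-- `Q` is the kernel of a surjection from a finite free module onto `X`, which splits.
theorem exists_prod_free [Module.Finite R X] [Module.Projective R X] :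
    ∃ (Q : Type u) (_ : AddCommGroup Q) (_ : Module R Q),
      Module.Finite R Q ∧ Module.Projective R Q ∧ Module.Free R (X × Q) := by
  obtain ⟨n, f, -, hf, -⟩ := Module.Finite.exists_comp_eq_id_of_projective R X
  obtain ⟨e⟩ := nonempty_equiv_prod (LinearMap.ker f).injective_subtype
    (LinearMap.exact_subtype_ker_map f) hf
  refine ⟨LinearMap.ker f, inferInstance, inferInstance,
    .of_surjective (LinearMap.fst R _ X ∘ₗ e.toLinearMap)
      (Prod.fst_surjective.comp e.surjective),
    .of_split (e.symm.toLinearMap ∘ₗ LinearMap.inl R _ X) (LinearMap.fst R _ X ∘ₗ e.toLinearMap)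
      (by ext; simp), .of_equiv (e.trans (LinearEquiv.prodComm R _ X))⟩

end

/-! ### Direct sums and exact sequences in `Nil(R)`. -/

namespace NilObj

variable {L M N M' N' : NilObj (PCat R)}

instance (M : NilObj (PCat R)) : Module.Finite R M.obj.obj := M.obj.property.1

instance (M : NilObj (PCat R)) : Module.Projective R M.obj.obj := M.obj.property.2

/-- The linear map underlying a morphism of `Nil(R)`. -/
abbrev lin (φ : M ⟶ N) : M.obj.obj →ₗ[R] N.obj.obj := φ.hom.hom.hom

/-- The linear map underlying the nilpotent endomorphism. -/
abbrev nu (M : NilObj (PCat R)) : M.obj.obj →ₗ[R] M.obj.obj :=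
  (M.ν : M.obj ⟶ M.obj).hom.hom

theorem lin_nu (φ : M ⟶ N) : lin φ ∘ₗ M.nu = N.nu ∘ₗ lin φ :=
  congrArg (fun f : M.obj ⟶ N.obj => f.hom.hom) φ.comm

theorem lin_injective {φ ψ : M ⟶ N} (h : lin φ = lin ψ) : φ = ψ :=
  hom_ext (ObjectProperty.hom_ext _ (ModuleCat.hom_ext h))

/-- The morphism with a given underlying linear map. -/
def ofLin (f : M.obj.obj →ₗ[R] N.obj.obj) (h : f ∘ₗ M.nu = N.nu ∘ₗ f) : M ⟶ N :=
  ⟨ObjectProperty.homMk (ModuleCat.ofHom f), ObjectProperty.hom_ext _ (ModuleCat.hom_ext h)⟩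

theorem pow_hom {P : ObjectProperty (ModuleCat.{u} R)} {X : P.FullSubcategory} (f : End X) (k : ℕ) :
    (f ^ k : X ⟶ X).hom.hom = ((f : X ⟶ X).hom.hom ^ k : Module.End R X.obj) := by
  induction k with
  | zero => rfl
  | succ k ih =>
    rw [pow_succ', pow_succ', ← ih]
    rfl

theorem isNilpotent_nu (M : NilObj (PCat R)) : IsNilpotent (M.nu : Module.End R M.obj.obj) := by
  obtain ⟨k, hk⟩ := M.nilpotent
  exact ⟨k, (pow_hom _ k).symm.trans
    (congrArg (fun f : M.obj ⟶ M.obj => f.hom.hom) hk)⟩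

/-- The object of `Nil(R)` given by a nilpotent endomorphism of a module. -/
def ofEnd (V : Type u) [AddCommGroup V] [Module R V] (h : Module.Finite R V)
    (h' : Module.Projective R V) (f : Module.End R V) (hf : IsNilpotent f) : NilObj (PCat R) where
  obj := ⟨ModuleCat.of R V, h, h'⟩
  ν := ObjectProperty.homMk (ModuleCat.ofHom f)
  nilpotent := by
    obtain ⟨k, hk⟩ := hf
    exact ⟨k, ObjectProperty.hom_ext _ (ModuleCat.hom_ext ((pow_hom _ k).trans hk))⟩

/-- The linear equivalence underlying an isomorphism. -/
def linEquiv (e : M ≅ N) : M.obj.obj ≃ₗ[R] N.obj.obj :=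
  LinearEquiv.ofLinearMap (lin e.hom) (lin e.inv) (congrArg lin e.inv_hom_id) (congrArg lin e.hom_inv_id)

theorem isZero_iff : IsZero M ↔ Subsingleton M.obj.obj := by
  rw [IsZero.iff_id_eq_zero]
  exact ⟨fun h => ⟨fun x y =>
    (LinearMap.congr_fun (congrArg lin h) x).trans (LinearMap.congr_fun (congrArg lin h) y).symm⟩,
    fun h => lin_injective (LinearMap.ext fun _ => Subsingleton.elim _ _)⟩

/-- The direct sum of two objects of `Nil(R)`, with its inclusions and projections. -/
def prodBicone (M N : NilObj (PCat R)) : BinaryBicone M N where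
  pt := ofEnd (M.obj.obj × N.obj.obj) inferInstance inferInstance (M.nu.prodMap N.nu) (by
    obtain ⟨k, hk⟩ := M.isNilpotent_nu
    obtain ⟨l, hl⟩ := N.isNilpotent_nu
    refine ⟨k + l, ?_⟩
    have : ∀ j, (M.nu.prodMap N.nu : Module.End R (M.obj.obj × N.obj.obj)) ^ j =
        LinearMap.prodMap ((M.nu : Module.End R M.obj.obj) ^ j)
          ((N.nu : Module.End R N.obj.obj) ^ j) := fun j => by
      induction j with
      | zero => rfl
      | succ j ih => rw [pow_succ, ih, pow_succ, pow_succ]; rfl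
    rw [this, pow_add, pow_add, hk, hl, zero_mul, mul_zero]
    rfl)
  fst := ofLin (LinearMap.fst R _ _) rfl
  snd := ofLin (LinearMap.snd R _ _) rfl
  inl := ofLin (LinearMap.inl R _ _) (LinearMap.ext fun x =>
    Prod.ext (rfl : M.nu x = M.nu x) (map_zero N.nu).symm)
  inr := ofLin (LinearMap.inr R _ _) (LinearMap.ext fun x =>
    Prod.ext (map_zero M.nu).symm (rfl : N.nu x = N.nu x))
  inl_fst := rfl
  inl_snd := rfl
  inr_fst := rfl
  inr_snd := rfl

theorem lin_comm (φ : M ⟶ N) (x : M.obj.obj) : lin φ (M.nu x) = N.nu (lin φ x) :=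
  LinearMap.congr_fun (lin_nu φ) x

/-- The direct sum is a biproduct. -/
def prodIsBilimit (M N : NilObj (PCat R)) : (prodBicone M N).IsBilimit :=
  isBilimitMk _
    (fun f g => ofLin ((lin f).prod (lin g))
      (LinearMap.ext fun x => Prod.ext (lin_comm f x) (lin_comm g x)))
    (fun _ _ => rfl) (fun _ _ => rfl)
    (fun _ _ h h' => lin_injective (LinearMap.ext fun x => Prod.ext
      (LinearMap.congr_fun (congrArg lin h) x) (LinearMap.congr_fun (congrArg lin h') x)))
    (fun {T} f g => ofLin ((lin f).coprod (lin g)) (LinearMap.ext fun x =>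
      (congrArg₂ (· + ·) (lin_comm f x.1) (lin_comm g x.2)).trans (map_add T.nu _ _).symm))
    (fun _ _ => lin_injective (LinearMap.coprod_inl _ _))
    (fun _ _ => lin_injective (LinearMap.coprod_inr _ _))
    (fun _ _ h h' => lin_injective (LinearMap.prod_ext (congrArg lin h) (congrArg lin h')))

instance : HasBinaryBiproducts (NilObj (PCat R)) :=
  ⟨fun M N => .mk ⟨prodBicone M N, prodIsBilimit M N⟩⟩

/-- The direct sum of modules is isomorphic to the biproduct. -/
noncomputable def prodIso (M N : NilObj (PCat R)) : (prodBicone M N).pt ≅ M ⊞ N :=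
  biprod.uniqueUpToIso M N (prodIsBilimit M N)

/-- The linear equivalence between the direct sum of modules and the biproduct. -/
noncomputable def prodEquiv (M N : NilObj (PCat R)) :
    (M.obj.obj × N.obj.obj) ≃ₗ[R] (M ⊞ N).obj.obj :=
  linEquiv (prodIso M N)

/-- The direct sum of two morphisms. -/
def prodMap (f : M ⟶ N) (g : M' ⟶ N') : (prodBicone M M').pt ⟶ (prodBicone N N').pt :=
  ofLin ((lin f).prodMap (lin g))
    (LinearMap.ext fun x => Prod.ext (lin_comm f x.1) (lin_comm g x.2))

/-- Short exact sequences of `Nil(R)`. -/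
def IsSes (f : L ⟶ M) (g : M ⟶ N) : Prop :=
  Function.Injective (lin f) ∧ Function.Exact (lin f) (lin g) ∧ Function.Surjective (lin g)

theorem IsSes.of_iso {X Y Z X' Y' Z' : NilObj (PCat R)} {f : X ⟶ Y} {g : Y ⟶ Z} {f' : X' ⟶ Y'}
    {g' : Y' ⟶ Z'} (eX : X ≅ X') (eY : Y ≅ Y') (eZ : Z ≅ Z') (hf : f ≫ eY.hom = eX.hom ≫ f')
    (hg : g ≫ eZ.hom = eY.hom ≫ g') (h : IsSes f g) : IsSes f' g' := by
  have hf' : lin f' ∘ₗ linEquiv eX = linEquiv eY ∘ₗ lin f := (congrArg lin hf).symm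
  have hg' : lin g' ∘ₗ linEquiv eY = linEquiv eZ ∘ₗ lin g := (congrArg lin hg).symm
  refine ⟨?_, (Function.Exact.iff_of_ladder_linearEquiv hf' hg').2 h.2.1, ?_⟩
  · rw [← (linEquiv eX).injective_comp]
    exact (congrArg (fun φ => Function.Injective (DFunLike.coe φ)) hf').mpr
      ((linEquiv eY).injective.comp h.1)
  · rw [← (linEquiv eY).surjective_comp]
    exact (congrArg (fun φ => Function.Surjective (DFunLike.coe φ)) hg').mpr
      ((linEquiv eZ).surjective.comp h.2.2)

theorem isSes_inl_snd (M N : NilObj (PCat R)) :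
    IsSes (biprod.inl : M ⟶ M ⊞ N) (biprod.snd : M ⊞ N ⟶ N) :=
  IsSes.of_iso (f := (prodBicone M N).inl) (g := (prodBicone M N).snd) (Iso.refl _) (prodIso M N)
    (Iso.refl _) ((inl_uniqueUpToIso_hom _).trans (Category.id_comp _).symm)
    ((Category.comp_id _).trans (biprod.lift_snd _ _).symm)
    ⟨LinearMap.inl_injective, Function.Exact.inl_snd, LinearMap.snd_surjective⟩

theorem IsSes.map {X Y Z X' Y' Z' : NilObj (PCat R)} {f : X ⟶ Y} {g : Y ⟶ Z} {f' : X' ⟶ Y'}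
    {g' : Y' ⟶ Z'} (h : IsSes f g) (h' : IsSes f' g') :
    IsSes (biprod.map f f') (biprod.map g g') :=
  IsSes.of_iso (f := prodMap f f') (g := prodMap g g') (prodIso _ _) (prodIso _ _) (prodIso _ _)
    (comp_uniqueUpToIso_hom _ _ rfl rfl) (comp_uniqueUpToIso_hom _ _ rfl rfl)
    ⟨Function.Injective.prodMap h.1 h'.1, fun x => by
      have h1 := h.2.1 x.1
      have h2 := h'.2.1 x.2
      constructor
      · intro hx
        obtain ⟨a, ha⟩ := h1.1 (congrArg Prod.fst hx)
        obtain ⟨b, hb⟩ := h2.1 (congrArg Prod.snd hx)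
        exact ⟨(a, b), Prod.ext ha hb⟩
      · rintro ⟨a, rfl⟩
        exact Prod.ext (h1.2 ⟨a.1, rfl⟩) (h2.2 ⟨a.2, rfl⟩),
      Function.Surjective.prodMap h.2.2 h'.2.2⟩

end NilObj

instance : (NilCat R).HasSums where
  zero := ⟨NilObj.ofEnd PUnit inferInstance inferInstance 0 IsNilpotent.zero,
    NilObj.isZero_iff.2 (inferInstanceAs (Subsingleton PUnit))⟩
  has_binary_biproduct :=
    (inferInstance : HasBinaryBiproducts (NilObj (PCat R))).has_binary_biproduct
  ses_of_iso := fun eX eY eZ hf hg h => NilObj.IsSes.of_iso (R := R) eX eY eZ hf hg h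
  ses_inl_snd := NilObj.isSes_inl_snd (R := R)
  ses_map := fun h h' => NilObj.IsSes.map (R := R) h h'
  isZero_left := fun h hY =>
    have := NilObj.isZero_iff.1 hY
    NilObj.isZero_iff.2 h.1.subsingleton

/-! ### Cofinality of free modules in `Nil(R)`, the base of the induction. -/

namespace NilObj

variable (R) in
-- `C` and `S` see only the underlying module, so complements may carry the zero endomorphism. Short
-- exact sequences split as sequences of modules, though not necessarily compatibly with `ν`; this
-- gives closure of `C` under extensions and kernels.
theorem isCofinal : IsCofinal (NilCat R) (fun M : NilObj (PCat R) => M.nu = 0)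
    (fun M : NilObj (PCat R) => StablyFree R M.obj.obj)
    (fun M : NilObj (PCat R) => Module.Free R M.obj.obj) where
  D_of_iso := fun {M N : NilObj (PCat R)} e h => LinearMap.ext fun x => by
    obtain ⟨x, rfl⟩ := (linEquiv e).surjective x
    refine (lin_comm e.hom x).symm.trans ?_
    rw [h]
    exact map_zero (lin e.hom)
  C_of_iso := fun {M N : NilObj (PCat R)} e h => h.of_equiv (linEquiv e)
  S_of_iso := fun {M N : NilObj (PCat R)} e h => have := h; .of_equiv (linEquiv e)
  D_of_isZero := fun {M : NilObj (PCat R)} h =>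
    have := isZero_iff.1 h
    Subsingleton.elim _ _
  C_of_isZero := fun {M : NilObj (PCat R)} h =>
    have := isZero_iff.1 h
    StablyFree.of_free R M.obj.obj
  S_of_isZero := fun {M : NilObj (PCat R)} h =>
    have := isZero_iff.1 h
    (inferInstance : Module.Free R M.obj.obj)
  D_biprod := fun {M N : NilObj (PCat R)} hM hN => LinearMap.ext fun x => by
    obtain ⟨x, rfl⟩ := (prodEquiv M N).surjective x
    refine (lin_comm (prodIso M N).hom x).symm.trans ((congrArg _ ?_).trans (map_zero _))
    exact Prod.ext (LinearMap.congr_fun hM x.1) (LinearMap.congr_fun hN x.2)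
  S_biprod := fun {M N : NilObj (PCat R)} hM hN =>
    have : Module.Free R M.obj.obj := hM
    have : Module.Free R N.obj.obj := hN
    Module.Free.of_equiv (prodEquiv M N)
  C_middle := fun {L M N : NilObj (PCat R)} f g h hL hN =>
    have ⟨e⟩ := nonempty_equiv_prod h.1 h.2.1 h.2.2
    (hL.prod hN).of_equiv e.symm
  C_left := fun {L M N : NilObj (PCat R)} f g h hM hN =>
    have ⟨e⟩ := nonempty_equiv_prod h.1 h.2.1 h.2.2
    (hM.of_equiv e).left_of_prod hN
  exists_compl := fun M : NilObj (PCat R) => by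
    obtain ⟨Q, _, _, h1, h2, h3⟩ := exists_prod_free R M.obj.obj
    exact ⟨ofEnd Q h1 h2 0 IsNilpotent.zero, rfl,
      (StablyFree.of_free R (M.obj.obj × Q)).of_equiv (prodEquiv M (ofEnd Q h1 h2 0 _))⟩
  exists_S := fun {M : NilObj (PCat R)} h => by
    obtain ⟨F, _, _, h1, h2, h3⟩ := h
    exact ⟨ofEnd F h1 inferInstance 0 IsNilpotent.zero, rfl, h2,
      h3.of_equiv' (prodEquiv M (ofEnd F h1 inferInstance 0 _))⟩

variable (R) in
theorem hasLifts_freeIncl : HasLifts (freeIncl R).nil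
    (fun M : NilObj (PCat R) => Module.Free R M.obj.obj) where
  full := ⟨fun {M N : NilObj (FreeCat R)} f =>
    have hf := congrArg InducedCategory.Hom.hom (Hom.comm f)
    ⟨(⟨ObjectProperty.homMk (Hom.hom f).hom, ObjectProperty.hom_ext _ hf⟩ : Hom M N), rfl⟩⟩
  faithful := ⟨fun {M N : NilObj (FreeCat R)} (f g : M ⟶ N) h =>
    hom_ext (ObjectProperty.hom_ext _ (ModuleCat.hom_ext (congrArg lin h)))⟩
  reflects := fun _ _ h => h
  exists_iso := fun {M : NilObj (PCat R)} h =>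
    ⟨(⟨⟨M.obj.obj, inferInstance, h⟩, ObjectProperty.homMk (M.ν : M.obj ⟶ M.obj).hom, by
      obtain ⟨k, hk⟩ := M.isNilpotent_nu
      exact ⟨k, ObjectProperty.hom_ext _ (ModuleCat.hom_ext ((pow_hom _ k).trans hk))⟩⟩ :
      NilObj (FreeCat R)), ⟨Iso.refl M⟩⟩

variable (R) in
theorem fixes_killNil : Fixes (killNil (PCat R)) (fun M : NilObj (PCat R) => M.nu = 0) :=
  ⟨fun (M : NilObj (PCat R)) h =>
    { hom := ofLin (M := M.kill) .id (by rw [h]; rfl)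
      inv := ofLin (N := M.kill) .id (by rw [h]; rfl)
      hom_inv_id := rfl
      inv_hom_id := rfl }, fun _ _ _ _ _ => rfl⟩

end NilObj

end

/-! ### The splitting by `P ↦ (P, 0)` and the quotient isomorphism. -/

/-- The identity functor of an exact category. -/
def ExFunctor.id (A : ExCat.{u}) : ExFunctor A A where
  F := 𝟭 A.Obj
  map_ses _ _ h := h

/-- The composite of two exact functors. -/
def ExFunctor.comp {A B C : ExCat.{u}} (G : ExFunctor A B) (H : ExFunctor B C) :
    ExFunctor A C where
  F := G.F ⋙ H.F
  zero := ⟨fun X Y => by simp⟩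
  map_ses f g h := H.map_ses _ _ (G.map_ses f g h)

theorem ExFunctor.bqn_id (A : ExCat.{u}) : ∀ n, (ExFunctor.id A).bqn n = ExFunctor.id (A.bqn n)
  | 0 => rfl
  | n + 1 => congrArg ExFunctor.bq (bqn_id A n)

theorem ExFunctor.bqn_comp {A B C : ExCat.{u}} (G : ExFunctor A B) (H : ExFunctor B C) :
    ∀ n, (G.comp H).bqn n = (G.bqn n).comp (H.bqn n)
  | 0 => rfl
  | n + 1 => congrArg ExFunctor.bq (bqn_comp G H n)

theorem ExFunctor.bqn_obj_comm {A B B' C : ExCat.{u}} {G : ExFunctor A B} {H : ExFunctor B C}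
    {G' : ExFunctor A B'} {H' : ExFunctor B' C} (h : G.comp H = G'.comp H') (n : ℕ)
    (X : (A.bqn n).Obj) :
    (H.bqn n).F.obj ((G.bqn n).F.obj X) = (H'.bqn n).F.obj ((G'.bqn n).F.obj X) := by
  have := (bqn_comp G H n).symm.trans ((congrArg (ExFunctor.bqn · n) h).trans (bqn_comp G' H' n))
  exact congrArg (fun K => K.F.obj X) this

/-- The functor `A ⟶ Nil(A)`, `P ↦ (P, 0)`. -/
def zeroNil (A : ExCat.{u}) : ExFunctor A A.nil where
  F :=
    { obj := fun X => (⟨X, (0 : X ⟶ X), 1, pow_one (M := End X) _⟩ : NilObj A)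
      map := fun f => (⟨f, zero_comp.trans comp_zero.symm⟩ : NilObj.Hom _ _)
      map_id := fun _ => rfl
      map_comp := fun _ _ => rfl }
  zero := ⟨fun _ _ => rfl⟩
  map_ses _ _ h := h

theorem K0.mem_of_cls {A : ExCat.{u}} {H : AddSubgroup (K0 A)} (h : ∀ X, K0.cls X ∈ H) (x : K0 A) :
    x ∈ H := by
  obtain ⟨a, rfl⟩ := QuotientAddGroup.mk_surjective x
  induction a using FreeAbelianGroup.induction_on with
  | zero => exact H.zero_mem
  | of X => exact h X
  | neg X hX => exact H.neg_mem hX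
  | add a b ha hb => exact H.add_mem ha hb

theorem K0.hom_ext {A : ExCat.{u}} {M : Type*} [AddGroup M] {f g : K0 A →+ M}
    (h : ∀ X, f (K0.cls X) = g (K0.cls X)) : f = g :=
  AddMonoidHom.ext fun x => K0.mem_of_cls (H := f.eqLocus g) h x

theorem K0.map_forgetNil_zeroNil (A : ExCat.{u}) (n : ℕ) (x : K0 (A.bqn n)) :
    K0.map ((forgetNil A).bqn n) (K0.map ((zeroNil A).bqn n) x) = x := by
  refine DFunLike.congr_fun (K0.hom_ext (f := (K0.map _).comp (K0.map _))
    (g := AddMonoidHom.id _) fun X => ?_) x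
  have h : (zeroNil A).comp (forgetNil A) = ExFunctor.id A := rfl
  have := (ExFunctor.bqn_comp _ _ n).symm.trans
    ((congrArg (ExFunctor.bqn · n) h).trans (ExFunctor.bqn_id A n))
  rw [AddMonoidHom.comp_apply, K0.map_cls, K0.map_cls]
  exact congrArg (fun K => K0.cls (K.F.obj X)) this

theorem K0.map_killNil (A : ExCat.{u}) (n : ℕ) (x : K0 (A.nil.bqn n)) :
    K0.map ((killNil A).bqn n) x =
      K0.map ((zeroNil A).bqn n) (K0.map ((forgetNil A).bqn n) x) := by
  refine DFunLike.congr_fun (K0.hom_ext (g := (K0.map _).comp (K0.map _)) fun X => ?_) x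
  have h : killNil A = (forgetNil A).comp (zeroNil A) := rfl
  rw [AddMonoidHom.comp_apply, K0.map_cls, K0.map_cls, K0.map_cls, h, ExFunctor.bqn_comp]
  rfl

variable {R : Type u} [CommRing R] {n : ℕ}

theorem freeCls_zeroNu (F : NilFreeCx R n) :
    freeCls (zeroNu F) = K0.map ((killNil (PCat R)).bqn n) (freeCls F) := by
  have h : (killNil (FreeCat R)).comp (freeIncl R).nil =
    (freeIncl R).nil.comp (killNil (PCat R)) := rfl
  rw [freeCls, freeCls, K0.map_cls, zeroNu, ExFunctor.bqn_obj_comm h]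

theorem sub_map_killNil_mem (x : K0 ((NilCat R).bqn n)) :
    x - K0.map ((killNil (PCat R)).bqn n) x ∈ NilTilde R n := by
  rw [NilTilde, AddMonoidHom.mem_ker, map_sub, K0.map_killNil, K0.map_forgetNil_zeroNil, sub_self]

theorem freeCls_sub_mem (F : NilFreeCx R n) :
    freeCls F - freeCls (zeroNu F) ∈ NilTilde R n := by
  rw [freeCls_zeroNu]
  exact sub_map_killNil_mem _

/-- The correction term `c` between `[X]` and the free class is fixed by `killNil`, so it cancels
from the difference. -/
theorem exists_cls_sub_eq (X : ((NilCat R).bqn n).Obj) : ∃ F : NilFreeCx R n,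
    K0.cls X - K0.map ((killNil (PCat R)).bqn n) (K0.cls X) =
      freeCls F - freeCls (zeroNu F) := by
  obtain ⟨F, c, hc, hF⟩ := (NilObj.isCofinal R).exists_cls_eq_add (NilObj.hasLifts_freeIncl R)
    (NilObj.fixes_killNil R) n X
  refine ⟨F, ?_⟩
  rw [freeCls_zeroNu, freeCls, hF, map_add, hc, add_sub_add_right_eq_sub]

variable (R n) in
/-- The quotient map, restricted to the kernels of the forgetful maps. -/
def nilTildeToNilGrp : NilTilde R n →+ NilGrp R n :=
  ((QuotientAddGroup.mk' (diagSub (NilCat R) n)).comp (NilTilde R n).subtype).codRestrict _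
    fun x => by
      have hx : K0.map ((forgetNil (PCat R)).bqn n) x = 0 := x.2
      change (QuotientAddGroup.mk (K0.map ((forgetNil (PCat R)).bqn n) x) : Kn (PCat R) n) = 0
      rw [hx]
      rfl

theorem ker_nilTildeToNilGrp : (nilTildeToNilGrp R n).ker = TTilde R n := by
  ext x
  rw [AddMonoidHom.mem_ker, TTilde, AddSubgroup.mem_addSubgroupOf,
    ← QuotientAddGroup.eq_zero_iff]
  exact Subtype.ext_iff

/-- Correct any representative `z` to `z - kill z`. The correction is harmless: the forgetful image
of `z` is in the diagonal subgroup, and `zeroNil` preserves diagonality. -/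
theorem nilTildeToNilGrp_surjective : Function.Surjective (nilTildeToNilGrp R n) := by
  rintro ⟨y, hy⟩
  obtain ⟨z, rfl⟩ := QuotientAddGroup.mk_surjective y
  have hz : K0.map ((forgetNil (PCat R)).bqn n) z ∈ diagSub (PCat R) n :=
    (QuotientAddGroup.eq_zero_iff _).1 hy
  refine ⟨⟨_, sub_map_killNil_mem z⟩, Subtype.ext ?_⟩
  change (QuotientAddGroup.mk (z - K0.map ((killNil (PCat R)).bqn n) z) : Kn (NilCat R) n) =
    QuotientAddGroup.mk z
  rw [QuotientAddGroup.eq_iff_sub_mem, sub_sub_cancel_left, neg_mem_iff, K0.map_killNil]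
  exact diagSub_le (zeroNil (PCat R)) n hz

variable (R n) in
/-- `NilTilde / TTilde` is isomorphic to `Nil_n(R)` by the quotient map. -/
noncomputable def nilTildeQuotientEquiv : (NilTilde R n ⧸ TTilde R n) ≃+ NilGrp R n :=
  (QuotientAddGroup.quotientAddEquivOfEq ker_nilTildeToNilGrp.symm).trans
    (QuotientAddGroup.quotientKerEquivOfSurjective _ nilTildeToNilGrp_surjective)

end NilK

theorem theorem5p8 {R : Type u} [CommRing R] (n : ℕ) (hn : 1 < n) :
    ∃ e : (NilK.NilTilde R n ⧸ NilK.TTilde R n) ≃+ NilK.NilGrp R n,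
      (∀ x : NilK.NilTilde R n,
        ((e (QuotientAddGroup.mk x) : NilK.NilGrp R n) : NilK.Kn (NilK.NilCat R) n) =
          QuotientAddGroup.mk (x : NilK.K0 (NilK.ExCat.bqn (NilK.NilCat R) n))) ∧
      (∀ F : NilK.NilFreeCx R n,
        NilK.freeCls F - NilK.freeCls (NilK.zeroNu F) ∈ NilK.NilTilde R n) ∧
      AddSubgroup.closure
        {y : NilK.NilGrp R n | ∃ (F : NilK.NilFreeCx R n) (x : NilK.NilTilde R n),
          (x : NilK.K0 (NilK.ExCat.bqn (NilK.NilCat R) n)) =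
            NilK.freeCls F - NilK.freeCls (NilK.zeroNu F) ∧
          y = e (QuotientAddGroup.mk x)} = ⊤ := by
  refine ⟨NilK.nilTildeQuotientEquiv R n, fun _ => rfl, NilK.freeCls_sub_mem,
    (AddSubgroup.eq_top_iff' _).2 fun y => ?_⟩
  obtain ⟨x, rfl⟩ := NilK.nilTildeToNilGrp_surjective y
  -- `1 - kill` followed by the quotient map, defined on all of `K_0`, where checking on classes of
  -- objects is possible.
  let δ : NilK.K0 ((NilK.NilCat R).bqn n) →+ NilK.NilGrp R n :=
    (NilK.nilTildeToNilGrp R n).comp (AddMonoidHom.codRestrict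
      (AddMonoidHom.id _ - NilK.K0.map ((NilK.killNil (NilK.PCat R)).bqn n)) _
      NilK.sub_map_killNil_mem)
  -- `kill` factors through the forgetful map, so it vanishes on `NilTilde` and `1 - kill` is the
  -- identity there.
  have hδ : NilK.nilTildeToNilGrp R n x = δ x := by
    refine congrArg _ (Subtype.ext ?_)
    have hx : NilK.K0.map ((NilK.forgetNil (NilK.PCat R)).bqn n) x = 0 := x.2
    change x.1 = x.1 - NilK.K0.map _ x.1
    rw [NilK.K0.map_killNil, hx, map_zero, sub_zero]
  rw [hδ]
  refine NilK.K0.mem_of_cls (H := (AddSubgroup.closure _).comap δ) (fun X => ?_) x.1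
  obtain ⟨F, hF⟩ := NilK.exists_cls_sub_eq X
  exact AddSubgroup.subset_closure ⟨F, _, hF, rfl⟩
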